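/- For an integer $n\ge 2$ let $UHF_n=(M_n)^{\otimes\infty}$ be the UHF algebra obtained as the C$^*$-inductive limit of the matrix algebras $M_n^{\otimes k}$ along the embeddings $A\mapsto A\otimes I$, and let $E^{(n)}_{i,j}$ be the standard matrix units of $M_n$. For $J=(j_1,j_2,\ldots)\in\{1,\ldots,n\}^{\infty}$ let $\omega_J$ be the product of the pure states of $M_n$ given by the diagonal matrix units $E^{(n)}_{j_l,j_l}$, that is, the state of $UHF_n$ with $$\omega_J(E^{(n)}_{l_1,k_1}\otimes\cdots\otimes E^{(n)}_{l_r,k_r})=\delta_{l_1,j_1}\cdots\delta_{l_r,j_r}\,\delta_{k_1,j_1}\cdots\delta_{k_r,j_r}\qquad(r\ge 1).$$ Let $\pi_J$ be the GNS representation of $UHF_n$ by $\omega_J$, and let $P_n[J]$ be the unitary equivalence class of $\pi_J$. For $n,m\ge 2$ let $\varphi: UHF_{nm}\to UHF_n\otimes UHF_m$ (minimal C$^*$-tensor product) be the $*$-isomorphism with $$\varphi(E^{(nm)}_{l_1,k_1}\otimes\cdots\otimes E^{(nm)}_{l_r,k_r})=(E^{(n)}_{l_1',k_1'}\otimes\cdots\otimes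 E^{(n)}_{l_r',k_r'})\otimes(E^{(m)}_{l_1'',k_1''}\otimes\cdots\otimes E^{(m)}_{l_r'',k_r''}),$$ where $l_i=m(l_i'-1)+l_i''$ and $k_i=m(k_i'-1)+k_i''$ with $l_i',k_i'\in\{1,\ldots,n\}$ and $l_i'',k_i''\in\{1,\ldots,m\}$. For representations $\pi_1$ of $UHF_n$ and $\pi_2$ of $UHF_m$ put $\pi_1\otimes_\varphi\pi_2=(\pi_1\otimes\pi_2)\circ\varphi$, a representation of $UHF_{nm}$; this operation is well defined on unitary equivalence classes. Then the following holds. (i) For each $n\ge2$ and $J\in\{1,\ldots,n\}^\infty$, the representation $\pi_J$ is irreducible. (ii) For each $n\ge 2$ and $J,J'\in\{1,\ldots,n\}^\infty$, $P_n[J]=P_n[J']$ if and only if there is $r_0\geq 1$ such that $j_r=j'_r$ for all $r\ge r_0$. (iii) For all $n,m\ge2$, $J=(j_l)\in\{1,\ldots,n\}^\infty$ and $K=(k_l)\in\{1,\ldots,m\}^\infty$, $$P_n[J]\otimes_\varphi P_m[K]=P_{nm}[J\star K],\qquad (J\star K)_l=m(j_l-1)+k_l.$$ -/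

import Mathlib

/-- A C⋆-seminorm on a unital complex ⋆-algebra. -/
structure CStarSeminorm (A : Type*) [Ring A] [StarRing A] [Algebra ℂ A] where
  toFun : A → ℝ
  add_le' : ∀ a b, toFun (a + b) ≤ toFun a + toFun b
  smul' : ∀ (c : ℂ) a, toFun (c • a) = ‖c‖ * toFun a
  mul_le' : ∀ a b, toFun (a * b) ≤ toFun a * toFun b
  star_mul_self' : ∀ a, toFun (star a * a) = toFun a * toFun a

namespace CStarSeminorm

section Completion

variable {A : Type*} [Ring A] [StarRing A] [Algebra ℂ A]

/-- The ⋆-algebra `A` regarded as a seminormed algebra through the C⋆-seminorm `p`. -/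
def Pre (_p : CStarSeminorm A) : Type _ := A

variable (p : CStarSeminorm A)

instance : Ring p.Pre := inferInstanceAs (Ring A)
instance : StarRing p.Pre := inferInstanceAs (StarRing A)
instance : Algebra ℂ p.Pre := inferInstanceAs (Algebra ℂ A)
instance [StarModule ℂ A] : StarModule ℂ p.Pre := inferInstanceAs (StarModule ℂ A)

/-- The identity map `A → p.Pre`. -/
def toPre : A ≃⋆ₐ[ℂ] p.Pre := StarAlgEquiv.refl ℂ A

lemma apply_zero : p.toFun 0 = 0 := by simpa using p.smul' 0 0

lemma apply_neg (a : A) : p.toFun (-a) = p.toFun a := by simpa using p.smul' (-1) a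

lemma apply_nonneg (a : A) : 0 ≤ p.toFun a := by
  have h := p.add_le' a (-a)
  rw [add_neg_cancel, apply_zero, apply_neg] at h
  linarith

lemma apply_star (a : A) : p.toFun (star a) = p.toFun a := by
  have key : ∀ b : A, p.toFun b ≤ p.toFun (star b) := fun b => by
    have h1 := p.star_mul_self' b
    have h2 := p.mul_le' (star b) b
    rcases (p.apply_nonneg b).eq_or_lt with h | h
    · rw [← h]; exact p.apply_nonneg _
    · nlinarith
  exact le_antisymm (by simpa using key (star a)) (key a)

instance : SeminormedRing p.Pre :=
  { (inferInstance : Ring p.Pre),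
    (AddGroupSeminorm.toSeminormedAddCommGroup (E := p.Pre)
      { toFun := p.toFun
        map_zero' := p.apply_zero
        add_le' := p.add_le'
        neg' := p.apply_neg } : SeminormedAddCommGroup p.Pre) with
    norm_mul_le := p.mul_le' }

lemma norm_toPre (a : A) : ‖p.toPre a‖ = p.toFun a := rfl

lemma norm_pre_star (a : p.Pre) : ‖star a‖ = ‖a‖ := p.apply_star a

lemma norm_pre_star_mul_self (a : p.Pre) : ‖star a * a‖ = ‖a‖ * ‖a‖ := p.star_mul_self' a

instance : NormedSpace ℂ p.Pre where
  norm_smul_le c a := (p.smul' c a).le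

instance : NormedStarGroup p.Pre where
  norm_star_le a := (p.norm_pre_star a).le

/-- The Hausdorff completion of `A` with respect to `p`. -/
abbrev Completion : Type _ := UniformSpace.Completion p.Pre

open UniformSpace.Completion

noncomputable instance : Star p.Completion where
  star := UniformSpace.Completion.map star

lemma coe_star (a : p.Pre) : ((star a : p.Pre) : p.Completion) = star (a : p.Completion) :=
  (UniformSpace.Completion.map_coe star_isometry.uniformContinuous a).symm

@[fun_prop]
lemma continuous_completion_star : Continuous (star : p.Completion → p.Completion) :=
  UniformSpace.Completion.continuous_map

instance : ContinuousStar p.Completion := ⟨p.continuous_completion_star⟩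

noncomputable instance : StarRing p.Completion where
  star_involutive x := by
    induction x using induction_on with
    | hp => exact isClosed_eq (by fun_prop) continuous_id
    | ih a => rw [← coe_star, ← coe_star, star_star]
  star_mul x y := by
    induction x, y using induction_on₂ with
    | hp => exact isClosed_eq (by fun_prop) (by fun_prop)
    | ih a b => rw [← coe_mul, ← coe_star, ← coe_star, ← coe_star, ← coe_mul, star_mul]
  star_add x y := by
    induction x, y using induction_on₂ with
    | hp => exact isClosed_eq (by fun_prop) (by fun_prop)
    | ih a b => rw [← coe_add, ← coe_star, ← coe_star, ← coe_star, ← coe_add, star_add]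

/-- The canonical ⋆-homomorphism from `A` to its completion. -/
noncomputable def of : A →⋆ₐ[ℂ] p.Completion where
  toFun := fun a => (p.toPre a : p.Completion)
  map_one' := rfl
  map_mul' _ _ := coe_mul _ _
  map_zero' := rfl
  map_add' _ _ := coe_add _ _
  commutes' _ := rfl
  map_star' _ := p.coe_star _

lemma norm_of (a : A) : ‖p.of a‖ = p.toFun a := norm_coe (p.toPre a)

lemma denseRange_of : DenseRange p.of := denseRange_coe (α := p.Pre)

/-- The continuous extension to the completion of a linear map bounded by the seminorm. -/
noncomputable def extendL {E : Type*} [NormedAddCommGroup E] [NormedSpace ℂ E] [CompleteSpace E]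
    (f : A →ₗ[ℂ] E) (hf : ∀ a, ‖f a‖ ≤ p.toFun a) : p.Completion →L[ℂ] E :=
  (LinearMap.mkContinuous (f ∘ₗ (p.toPre.symm.toAlgEquiv.toLinearMap : p.Pre →ₗ[ℂ] A)) 1
    (fun a => by rw [one_mul]; exact hf a)).extend
      (toComplL : p.Pre →L[ℂ] p.Completion)

lemma extendL_of {E : Type*} [NormedAddCommGroup E] [NormedSpace ℂ E] [CompleteSpace E]
    (f : A →ₗ[ℂ] E) (hf : ∀ a, ‖f a‖ ≤ p.toFun a) (a : A) : p.extendL f hf (p.of a) = f a :=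
  ContinuousLinearMap.extend_eq _ denseRange_coe (isUniformInducing_coe _) (p.toPre a)

variable [StarModule ℂ A]

noncomputable instance : NormedAlgebra ℂ p.Completion where
  norm_smul_le := norm_smul_le

instance : StarModule ℂ p.Completion where
  star_smul c x := by
    induction x using induction_on with
    | hp =>
      exact isClosed_eq (p.continuous_completion_star.comp (continuous_const_smul c))
        ((continuous_const_smul (star c)).comp p.continuous_completion_star)
    | ih a => rw [← coe_smul, ← coe_star, ← coe_star, ← coe_smul, star_smul]

instance : CStarRing p.Completion where
  norm_mul_self_le x := by
    induction x using induction_on with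
    | hp => exact isClosed_le (by fun_prop) (by fun_prop)
    | ih a =>
      rw [← coe_star, ← coe_mul, norm_coe, norm_coe, norm_pre_star_mul_self]

/-- The completion of a unital complex ⋆-algebra with respect to a C⋆-seminorm is a unital
C⋆-algebra. -/
noncomputable instance : CStarAlgebra p.Completion where
  star_smul := star_smul

/-- The completion carries the order of a C⋆-algebra: `x ≤ y` iff `y - x` is positive. -/
noncomputable instance : PartialOrder p.Completion := CStarAlgebra.spectralOrder _

instance : StarOrderedRing p.Completion := CStarAlgebra.spectralOrderedRing _

/-- The extension to the completion of a ⋆-homomorphism which is bounded by the seminorm. -/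
noncomputable def lift {C : Type*} [CStarAlgebra C] (f : A →⋆ₐ[ℂ] C)
    (hf : ∀ a, ‖f a‖ ≤ p.toFun a) : p.Completion →⋆ₐ[ℂ] C :=
  have hf' : ∀ a, ‖f.toAlgHom.toLinearMap a‖ ≤ p.toFun a := hf
  { p.extendL f.toAlgHom.toLinearMap hf' with
    map_one' := (p.extendL_of f.toAlgHom.toLinearMap hf' 1).trans (map_one f)
    map_mul' := fun x y => by
      change p.extendL f.toAlgHom.toLinearMap hf' (x * y) = p.extendL f.toAlgHom.toLinearMap hf' x * p.extendL f.toAlgHom.toLinearMap hf' y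
      refine p.denseRange_of.induction_on₂ (p := fun x y =>
        p.extendL f.toAlgHom.toLinearMap hf' (x * y) = p.extendL f.toAlgHom.toLinearMap hf' x * p.extendL f.toAlgHom.toLinearMap hf' y) ?_ (fun a b => ?_) x y
      · exact isClosed_eq (by fun_prop) (by fun_prop)
      · rw [← map_mul, p.extendL_of _ hf', p.extendL_of _ hf', p.extendL_of _ hf']
        exact map_mul f a b
    map_zero' := map_zero (p.extendL f.toAlgHom.toLinearMap hf')
    commutes' := fun c => by
      change p.extendL f.toAlgHom.toLinearMap hf' (algebraMap ℂ _ c) = _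
      rw [← AlgHomClass.commutes p.of c, extendL_of]
      exact AlgHomClass.commutes f c
    map_star' := fun x => by
      change p.extendL f.toAlgHom.toLinearMap hf' (star x) = star (p.extendL f.toAlgHom.toLinearMap hf' x)
      refine p.denseRange_of.induction_on (p := fun x =>
        p.extendL f.toAlgHom.toLinearMap hf' (star x) = star (p.extendL f.toAlgHom.toLinearMap hf' x)) x ?_ (fun a => ?_)
      · exact isClosed_eq (by fun_prop) (by fun_prop)
      · rw [← map_star, extendL_of, extendL_of]
        exact map_star f a }

lemma lift_of {C : Type*} [CStarAlgebra C] (f : A →⋆ₐ[ℂ] C) (hf : ∀ a, ‖f a‖ ≤ p.toFun a)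
    (a : A) : p.lift f hf (p.of a) = f a := p.extendL_of _ hf a

lemma continuous_lift {C : Type*} [CStarAlgebra C] (f : A →⋆ₐ[ℂ] C)
    (hf : ∀ a, ‖f a‖ ≤ p.toFun a) : Continuous (p.lift f hf) :=
  (p.extendL f.toAlgHom.toLinearMap hf).continuous

open scoped ComplexOrder in
/-- The extension to the completion of a bounded positive linear functional. -/
noncomputable def extendPositive (f : A →ₗ[ℂ] ℂ) (hf : ∀ a, ‖f a‖ ≤ p.toFun a)
    (hpos : ∀ a, 0 ≤ f (star a * a)) : p.Completion →ₚ[ℂ] ℂ :=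
  PositiveLinearMap.mk₀ (p.extendL f hf).toLinearMap (fun x hx => by
    obtain ⟨y, rfl⟩ := CStarAlgebra.nonneg_iff_eq_star_mul_self.mp hx
    change 0 ≤ p.extendL f hf (star y * y)
    refine p.denseRange_of.induction_on (p := fun y => 0 ≤ p.extendL f hf (star y * y)) y
      ?_ (fun a => ?_)
    · exact isClosed_le (by fun_prop) (by fun_prop)
    · rw [← map_star, ← map_mul, extendL_of]
      exact hpos a)

open scoped ComplexOrder in
lemma extendPositive_of (f : A →ₗ[ℂ] ℂ) (hf : ∀ a, ‖f a‖ ≤ p.toFun a)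
    (hpos : ∀ a, 0 ≤ f (star a * a)) (a : A) : p.extendPositive f hf hpos (p.of a) = f a :=
  p.extendL_of f hf a

end Completion

section Constructions

variable {X : Type*} [Ring X] [StarRing X] [Algebra ℂ X]

/-- The C⋆-seminorm `x ↦ ‖f x‖` given by a ⋆-homomorphism `f` into a C⋆-algebra. -/
def ofHom {C : Type*} [CStarAlgebra C] (f : X →⋆ₐ[ℂ] C) : CStarSeminorm X where
  toFun x := ‖f x‖
  add_le' x y := by rw [map_add]; exact norm_add_le _ _
  smul' c x := by rw [map_smul, norm_smul]
  mul_le' x y := by rw [map_mul]; exact norm_mul_le _ _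
  star_mul_self' x := by rw [map_mul, map_star, CStarRing.norm_star_mul_self]

/-- The supremum of a pointwise bounded family of C⋆-seminorms. -/
noncomputable def iSup {ι : Type*} (p : ι → CStarSeminorm X)
    (hp : ∀ x, BddAbove (Set.range fun i => (p i).toFun x)) : CStarSeminorm X :=
  have h0 : ∀ x i, 0 ≤ (p i).toFun x := fun x i => (p i).apply_nonneg x
  have hle : ∀ x i, (p i).toFun x ≤ ⨆ j, (p j).toFun x := fun x i => le_ciSup (hp x) i
  have hs : ∀ x, 0 ≤ ⨆ i, (p i).toFun x := fun x => Real.iSup_nonneg (h0 x)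
  { toFun := fun x => ⨆ i, (p i).toFun x
    add_le' := fun x y => Real.iSup_le
      (fun i => ((p i).add_le' x y).trans (add_le_add (hle x i) (hle y i)))
      (add_nonneg (hs x) (hs y))
    smul' := fun c x => by
      simp_rw [fun i => (p i).smul' c x]
      exact (Real.mul_iSup_of_nonneg (norm_nonneg c) _).symm
    mul_le' := fun x y => Real.iSup_le
      (fun i => ((p i).mul_le' x y).trans (mul_le_mul (hle x i) (hle y i) (h0 y i) (hs x)))
      (mul_nonneg (hs x) (hs y))
    star_mul_self' := fun x => by
      apply le_antisymm
      · exact Real.iSup_le (fun i => ((p i).star_mul_self' x).le.trans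
          (mul_le_mul (hle x i) (hle x i) (h0 x i) (hs x))) (mul_nonneg (hs x) (hs x))
      · have hk : ∀ i, (p i).toFun x ≤ √(⨆ j, (p j).toFun (star x * x)) := fun i =>
          Real.le_sqrt_of_sq_le (by
            rw [sq, ← (p i).star_mul_self' x]; exact hle (star x * x) i)
        have hk' : (⨆ i, (p i).toFun x) ≤ √(⨆ j, (p j).toFun (star x * x)) :=
          Real.iSup_le hk (Real.sqrt_nonneg _)
        exact (mul_le_mul hk' hk' (hs x) (Real.sqrt_nonneg _)).trans
          (Real.mul_self_sqrt (hs _)).le }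

end Constructions

end CStarSeminorm

section UHF

open scoped Matrix.Norms.L2Operator

/-- The first `k` entries of a tuple of length `l ≥ k`. -/
def tupleInit {n k l : ℕ} (h : k ≤ l) (J : Fin l → Fin n) : Fin k → Fin n :=
  fun i => J (Fin.castLE h i)

/-- The entries from position `k` on of two tuples of length `l` agree. -/
def TailEq {n l : ℕ} (k : ℕ) (J K : Fin l → Fin n) : Prop :=
  ∀ i : Fin l, k ≤ (i : ℕ) → J i = K i

instance {n l : ℕ} (k : ℕ) (J K : Fin l → Fin n) : Decidable (TailEq k J K) :=
  inferInstanceAs (Decidable (∀ i : Fin l, k ≤ (i : ℕ) → J i = K i))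

/-- The tuple with the first `k` entries of `L` followed by the entries of `J` from `k` on. -/
def tupleGlue {n k l : ℕ} (L : Fin k → Fin n) (J : Fin l → Fin n) : Fin l → Fin n :=
  fun i => if h : (i : ℕ) < k then L ⟨i, h⟩ else J i

lemma tupleInit_glue {n k l : ℕ} (h : k ≤ l) (L : Fin k → Fin n) (J : Fin l → Fin n) :
    tupleInit h (tupleGlue L J) = L := by
  funext i; simp [tupleInit, tupleGlue]

lemma tailEq_glue {n k l : ℕ} (L : Fin k → Fin n) (J : Fin l → Fin n) :
    TailEq k J (tupleGlue L J) := by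
  intro i hi; simp [tupleGlue, not_lt.mpr hi]

lemma glue_init {n k l : ℕ} (h : k ≤ l) {J L : Fin l → Fin n} (hJL : TailEq k J L) :
    tupleGlue (tupleInit h L) J = L := by
  funext i
  by_cases hi : (i : ℕ) < k
  · simp [tupleInit, tupleGlue, hi]
  · simp [tupleGlue, hi, hJL i (not_lt.mp hi)]

lemma tuple_ext {n k l : ℕ} (h : k ≤ l) {J L : Fin l → Fin n} (hJL : TailEq k J L)
    (h' : tupleInit h J = tupleInit h L) : J = L := by
  rw [← glue_init h hJL, ← h', glue_init h (fun _ _ => rfl)]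

/-- The `k`-fold tensor power `M_n ⊗ ⋯ ⊗ M_n`, as the algebra of matrices indexed by `k`-tuples;
the matrix unit `Matrix.single J K 1` is `E_{j_1,k_1} ⊗ ⋯ ⊗ E_{j_k,k_k}`. -/
abbrev MatPow (n k : ℕ) : Type := Matrix (Fin k → Fin n) (Fin k → Fin n) ℂ

/-- The unital embedding `M ↦ M ⊗ I ⊗ ⋯ ⊗ I` of `M_n^{⊗ k}` into `M_n^{⊗ l}`. -/
def matPowEmbed (n : ℕ) (k l : ℕ) (h : k ≤ l) : MatPow n k →⋆ₐ[ℂ] MatPow n l where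
  toFun M := Matrix.of fun J K =>
    if TailEq k J K then M (tupleInit h J) (tupleInit h K) else 0
  map_one' := by
    ext J K
    by_cases hJK : J = K
    · subst hJK
      simp [TailEq]
    · by_cases ht : TailEq k J K
      · have : tupleInit h J ≠ tupleInit h K := fun e => hJK (tuple_ext h ht e)
        simp [ht, hJK, this]
      · simp [ht, hJK]
  map_mul' M N := by
    ext J K
    simp only [Matrix.of_apply, Matrix.mul_apply]
    by_cases ht : TailEq k J K
    · rw [if_pos ht]
      have tail : ∀ L, TailEq k J L → TailEq k L K := fun L hL i hi =>
        (hL i hi).symm.trans (ht i hi)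
      refine Finset.sum_of_injOn (fun L => tupleGlue L J) ?_ ?_ ?_ ?_
      · intro L _ L' _ hL
        have := congrArg (tupleInit h) hL
        simpa only [tupleInit_glue] using this
      · intro L _; simp
      · intro L _ hL
        have : ¬ TailEq k J L := fun hJL => hL ⟨tupleInit h L, by simp, glue_init h hJL⟩
        simp [this]
      · intro L _
        simp [tailEq_glue, tail _ (tailEq_glue L J), tupleInit_glue]
    · rw [if_neg ht]
      symm
      refine Finset.sum_eq_zero fun L _ => ?_
      by_cases h1 : TailEq k J L
      · have h2 : ¬ TailEq k L K := fun h2 => ht fun i hi => (h1 i hi).trans (h2 i hi)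
        simp [h2]
      · simp [h1]
  map_zero' := by ext J K; simp
  map_add' M N := by ext J K; by_cases ht : TailEq k J K <;> simp [ht]
  commutes' c := by
    ext J K
    by_cases hJK : J = K
    · subst hJK
      simp [TailEq, Matrix.algebraMap_matrix_apply]
    · by_cases ht : TailEq k J K
      · have : tupleInit h J ≠ tupleInit h K := fun e => hJK (tuple_ext h ht e)
        simp [ht, hJK, this, Matrix.algebraMap_matrix_apply]
      · simp [ht, hJK, Matrix.algebraMap_matrix_apply]
  map_star' M := by
    ext J K
    have : TailEq k J K ↔ TailEq k K J := 
      ⟨fun h i hi => (h i hi).symm, fun h i hi => (h i hi).symm⟩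
    by_cases ht : TailEq k K J <;> simp [Matrix.star_apply, ht, this]

lemma matPowEmbed_apply {n k l : ℕ} (h : k ≤ l) (M : MatPow n k) (J K : Fin l → Fin n) :
    matPowEmbed n k l h M J K =
      if TailEq k J K then M (tupleInit h J) (tupleInit h K) else 0 := rfl

instance (n : ℕ) : DirectedSystem (MatPow n) (matPowEmbed n · · ·) where
  map_self k M := by
    ext J K
    have : TailEq k J K := fun i hi => absurd i.2 (not_lt.mpr hi)
    rw [matPowEmbed_apply, if_pos this]; rfl
  map_map l j i hij hjk M := by
    ext J K
    simp only [matPowEmbed_apply]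
    by_cases h1 : TailEq i J K
    · have h2 : TailEq j J K := fun a ha => h1 a (hij.trans ha)
      have h3 : TailEq i (tupleInit hjk J) (tupleInit hjk K) := fun a ha =>
        h1 (Fin.castLE hjk a) ha
      rw [if_pos h2, if_pos h3, if_pos h1]; rfl
    · rw [if_neg h1]
      by_cases h2 : TailEq j J K
      · have h3 : ¬ TailEq i (tupleInit hjk J) (tupleInit hjk K) := fun h3 => h1 fun a ha => by
          by_cases haj : (a : ℕ) < j
          · exact h3 ⟨a, haj⟩ ha
          · exact h2 a (not_lt.mp haj)
        rw [if_pos h2, if_neg h3]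
      · rw [if_neg h2]

lemma matPowEmbed_injective (n : ℕ) [NeZero n] (k l : ℕ) (h : k ≤ l) :
    Function.Injective (matPowEmbed n k l h) := by
  intro M N hMN
  ext J K
  have := congrFun (congrFun hMN (tupleGlue J 0)) (tupleGlue K 0)
  have ht : TailEq k (tupleGlue J (0 : Fin l → Fin n)) (tupleGlue K 0) := fun i hi => by
    simp [tupleGlue, not_lt.mpr hi]
  simpa [matPowEmbed_apply, ht, tupleInit_glue] using this

lemma norm_matPowEmbed (n : ℕ) [NeZero n] (k l : ℕ) (h : k ≤ l) (M : MatPow n k) :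
    ‖matPowEmbed n k l h M‖ = ‖M‖ :=
  NonUnitalStarAlgHom.norm_map _ (matPowEmbed_injective n k l h) M

/-- The algebraic inductive limit of `M_n → M_n ⊗ M_n → M_n ⊗ M_n ⊗ M_n → ⋯`. -/
abbrev UHFLocal (n : ℕ) : Type := DirectLimit (MatPow n) (matPowEmbed n)

noncomputable instance (n : ℕ) : StarRing (UHFLocal n) where
  star_add := star_add

/-- The canonical map of a finite stage into the algebraic inductive limit. -/
noncomputable def UHFLocal.of (n k : ℕ) : MatPow n k →⋆ₐ[ℂ] UHFLocal n :=
  { DirectLimit.Algebra.of (MatPow n) (matPowEmbed n) k with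
    map_star' := fun _ => rfl }

/-- The C⋆-norm of the algebraic inductive limit, which restricts to the operator norm of every
finite stage. -/
noncomputable def uhfNorm (n : ℕ) [NeZero n] : CStarSeminorm (UHFLocal n) where
  toFun := DirectLimit.lift (matPowEmbed n) (fun _ M => ‖M‖)
    (fun k l h M => (norm_matPowEmbed n k l h M).symm)
  add_le' := DirectLimit.induction₂ _ fun k M N => by
    rw [DirectLimit.add_def]; exact norm_add_le M N
  smul' c := DirectLimit.induction _ fun k M => by
    rw [DirectLimit.smul_def]; exact norm_smul c M
  mul_le' := DirectLimit.induction₂ _ fun k M N => by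
    rw [DirectLimit.mul_def]; exact norm_mul_le M N
  star_mul_self' := DirectLimit.induction _ fun k M => by
    rw [DirectLimit.star_def, DirectLimit.mul_def]; exact CStarRing.norm_star_mul_self

/-- The UHF algebra `UHF_n = M_n ⊗ M_n ⊗ ⋯`, the C⋆-algebraic inductive limit of the matrix
algebras `M_n^{⊗ k}`. -/
def UHF (n : ℕ) [NeZero n] : Type := (uhfNorm n).Completion

noncomputable instance (n : ℕ) [NeZero n] : CStarAlgebra (UHF n) :=
  inferInstanceAs (CStarAlgebra (uhfNorm n).Completion)

noncomputable instance (n : ℕ) [NeZero n] : PartialOrder (UHF n) :=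
  inferInstanceAs (PartialOrder (uhfNorm n).Completion)

instance (n : ℕ) [NeZero n] : StarOrderedRing (UHF n) :=
  inferInstanceAs (StarOrderedRing (uhfNorm n).Completion)

/-- The inclusion of `M_n^{⊗ k}` into `UHF_n`. -/
noncomputable def UHF.of (n : ℕ) [NeZero n] (k : ℕ) : MatPow n k →⋆ₐ[ℂ] UHF n :=
  (uhfNorm n).of.comp (UHFLocal.of n k)

lemma UHF.of_embed (n : ℕ) [NeZero n] (k l : ℕ) (h : k ≤ l) (M : MatPow n k) :
    UHF.of n l (matPowEmbed n k l h M) = UHF.of n k M :=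
  congrArg (uhfNorm n).of (DirectLimit.Algebra.of_f (f := matPowEmbed n) h M)

/-- The ⋆-homomorphism out of the algebraic inductive limit given by a compatible family. -/
noncomputable def UHFLocal.lift (n : ℕ) {C : Type*} [CStarAlgebra C]
    (g : ∀ k, MatPow n k →⋆ₐ[ℂ] C)
    (hg : ∀ k l (h : k ≤ l) M, g l (matPowEmbed n k l h M) = g k M) : UHFLocal n →⋆ₐ[ℂ] C :=
  { DirectLimit.Algebra.lift (MatPow n) (matPowEmbed n) C (fun k => (g k).toAlgHom) hg with
    map_star' := DirectLimit.induction _ fun k M => by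
      rw [DirectLimit.star_def]; exact map_star (g k) M }

/-- The universal property of `UHF_n`: the ⋆-homomorphism given by a compatible family. -/
noncomputable def UHF.lift (n : ℕ) [NeZero n] {C : Type*} [CStarAlgebra C]
    (g : ∀ k, MatPow n k →⋆ₐ[ℂ] C)
    (hg : ∀ k l (h : k ≤ l) M, g l (matPowEmbed n k l h M) = g k M) : UHF n →⋆ₐ[ℂ] C :=
  (uhfNorm n).lift (UHFLocal.lift n g hg)
    (DirectLimit.induction _ fun k M => NonUnitalStarAlgHom.norm_apply_le (g k) M)

lemma UHF.lift_of (n : ℕ) [NeZero n] {C : Type*} [CStarAlgebra C]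
    (g : ∀ k, MatPow n k →⋆ₐ[ℂ] C)
    (hg : ∀ k l (h : k ≤ l) M, g l (matPowEmbed n k l h M) = g k M) (k : ℕ) (M : MatPow n k) :
    UHF.lift n g hg (UHF.of n k M) = g k M :=
  (uhfNorm n).lift_of _ _ _

end UHF

section State

open scoped Matrix.Norms.L2Operator ComplexOrder

/-- The initial segment of length `k` of a sequence. -/
def seqInit {n : ℕ} (J : ℕ → Fin n) (k : ℕ) : Fin k → Fin n := fun i => J i

lemma norm_matrix_entry_le {I : Type*} [Fintype I] [DecidableEq I] (M : Matrix I I ℂ) (i j : I) :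
    ‖M i j‖ ≤ ‖M‖ := by
  have h := Matrix.l2_opNorm_mulVec M (EuclideanSpace.single j (1 : ℂ))
  have h2 := (PiLp.norm_apply_le (p := 2)
    ((EuclideanSpace.equiv I ℂ).symm (M.mulVec (EuclideanSpace.single j (1 : ℂ)))) i).trans h
  simpa using h2

/-- The functional on the algebraic inductive limit whose value at a matrix `M` of `M_n^{⊗ k}` is
its diagonal entry at the initial segment of `J`; on matrix units it is
`E_{l_1,k_1} ⊗ ⋯ ⊗ E_{l_k,k_k} ↦ ∏ δ_{l_i,j_i} δ_{k_i,j_i}`. -/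
noncomputable def uhfStateLocal (n : ℕ) (J : ℕ → Fin n) : UHFLocal n →ₗ[ℂ] ℂ where
  toFun := DirectLimit.lift (matPowEmbed n) (fun k M => M (seqInit J k) (seqInit J k))
    (fun k l h M => by
      have ht : TailEq k (seqInit J l) (seqInit J l) := fun _ _ => rfl
      rw [matPowEmbed_apply, if_pos ht]; rfl)
  map_add' := DirectLimit.induction₂ _ fun k M N => by
    rw [DirectLimit.add_def]; rfl
  map_smul' c := DirectLimit.induction _ fun k M => by
    rw [DirectLimit.smul_def]; rfl

/-- The state `ω_{T(J)}` of `UHF_n`, the product of the pure states of `M_n` given by the diagonal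
matrix units `E_{j_1,j_1}, E_{j_2,j_2}, …`. -/
noncomputable def uhfState (n : ℕ) [NeZero n] (J : ℕ → Fin n) : UHF n →ₚ[ℂ] ℂ :=
  (uhfNorm n).extendPositive (uhfStateLocal n J)
    (DirectLimit.induction _ fun k M => norm_matrix_entry_le M _ _)
    (DirectLimit.induction _ fun k M => by
      rw [DirectLimit.star_def, DirectLimit.mul_def]
      change 0 ≤ (star M * M) (seqInit J k) (seqInit J k)
      rw [Matrix.mul_apply]
      exact Finset.sum_nonneg fun L _ => by
        rw [Matrix.star_apply]; exact star_mul_self_nonneg _)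

lemma uhfState_of (n : ℕ) [NeZero n] (J : ℕ → Fin n) (k : ℕ) (M : MatPow n k) :
    uhfState n J (UHF.of n k M) = M (seqInit J k) (seqInit J k) :=
  (uhfNorm n).extendPositive_of _ _ _ _

lemma uhfState_one (n : ℕ) [NeZero n] (J : ℕ → Fin n) : uhfState n J 1 = 1 := by
  rw [← map_one (UHF.of n 0), uhfState_of, Matrix.one_apply_eq]

lemma uhfState_single (n : ℕ) [NeZero n] (J : ℕ → Fin n) (k : ℕ) (L K : Fin k → Fin n) :
    uhfState n J (UHF.of n k (Matrix.single L K 1)) =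
      if L = seqInit J k ∧ K = seqInit J k then 1 else 0 := by
  rw [uhfState_of, Matrix.single_apply]

end State

section Representations

/-- A unital ⋆-representation of a unital C⋆-algebra on a complex Hilbert space. -/
structure StarRep (A : Type) [CStarAlgebra A] where
  H : Type
  [instNormed : NormedAddCommGroup H]
  [instInner : InnerProductSpace ℂ H]
  [instComplete : CompleteSpace H]
  π : A →⋆ₐ[ℂ] (H →L[ℂ] H)

namespace StarRep

attribute [instance] StarRep.instNormed StarRep.instInner StarRep.instComplete

variable {A B : Type} [CStarAlgebra A] [CStarAlgebra B]

/-- A representation is irreducible if its space is nonzero and the only closed invariant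
subspaces are the trivial ones. -/
def IsIrreducible (ρ : StarRep A) : Prop :=
  Nontrivial ρ.H ∧ ∀ K : Submodule ℂ ρ.H, IsClosed (K : Set ρ.H) →
    (∀ a : A, ∀ x ∈ K, ρ.π a x ∈ K) → K = ⊥ ∨ K = ⊤

/-- Unitary equivalence of representations. -/
def UnitaryEquiv (ρ σ : StarRep A) : Prop :=
  ∃ U : ρ.H ≃ₗᵢ[ℂ] σ.H, ∀ (a : A) (x : ρ.H), U (ρ.π a x) = σ.π a (U x)

instance setoid (A : Type) [CStarAlgebra A] : Setoid (StarRep A) where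
  r := UnitaryEquiv
  iseqv :=
    { refl := fun ρ => ⟨LinearIsometryEquiv.refl ℂ _, fun _ _ => rfl⟩
      symm := fun ⟨U, hU⟩ => ⟨U.symm, fun a x => by
        rw [LinearIsometryEquiv.symm_apply_eq, hU, LinearIsometryEquiv.apply_symm_apply]⟩
      trans := fun ⟨U, hU⟩ ⟨V, hV⟩ => ⟨U.trans V, fun a x => by
        simp [hU, hV]⟩ }

/-- Restriction of a representation along a ⋆-homomorphism. -/
noncomputable def comp (ρ : StarRep A) (f : B →⋆ₐ[ℂ] A) : StarRep B where
  H := ρ.H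
  π := ρ.π.comp f

open scoped ComplexOrder in
/-- The GNS representation of a positive linear functional. -/
noncomputable def gns [PartialOrder A] [StarOrderedRing A] (f : A →ₚ[ℂ] ℂ) : StarRep A where
  H := f.GNS
  π := f.gnsStarAlgHom

end StarRep

/-- The set of unitary equivalence classes of representations. -/
def RepClass (A : Type) [CStarAlgebra A] : Type 1 := Quotient (StarRep.setoid A)

end Representations

section Tensor

open scoped TensorProduct

/-- The Hilbert space tensor product. -/
abbrev HilbertTensor (H K : Type) [NormedAddCommGroup H] [InnerProductSpace ℂ H]
    [NormedAddCommGroup K] [InnerProductSpace ℂ K] : Type :=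
  UniformSpace.Completion (H ⊗[ℂ] K)

section Operators

variable {H K : Type} [NormedAddCommGroup H] [InnerProductSpace ℂ H]
    [NormedAddCommGroup K] [InnerProductSpace ℂ K]

/-- The tensor product `S ⊗ T` of bounded operators on the Hilbert space tensor product. -/
noncomputable def opTensor (S : H →L[ℂ] H) (T : K →L[ℂ] K) :
    HilbertTensor H K →L[ℂ] HilbertTensor H K :=
  (TensorProduct.mapL S T).completion

lemma opTensor_coe (S : H →L[ℂ] H) (T : K →L[ℂ] K) (x : H ⊗[ℂ] K) :
    opTensor S T (x : HilbertTensor H K) = (TensorProduct.mapL S T x : H ⊗[ℂ] K) :=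
  ContinuousLinearMap.completion_apply_coe _ _

lemma hilbertTensor_ext {S T : HilbertTensor H K →L[ℂ] HilbertTensor H K}
    (h : ∀ x : H ⊗[ℂ] K, S x = T x) : S = T := by
  ext x
  induction x using UniformSpace.Completion.induction_on with
  | hp => exact isClosed_eq (by fun_prop) (by fun_prop)
  | ih x => exact h x

lemma opTensor_mul (S S' : H →L[ℂ] H) (T T' : K →L[ℂ] K) :
    opTensor (S * S') (T * T') = opTensor S T * opTensor S' T' := by
  refine hilbertTensor_ext fun x => ?_
  rw [mul_apply_eq_comp, opTensor_coe, opTensor_coe, opTensor_coe,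
    TensorProduct.mapL_mul]
  rfl

lemma opTensor_one : opTensor (1 : H →L[ℂ] H) (1 : K →L[ℂ] K) = 1 := by
  refine hilbertTensor_ext fun x => ?_
  rw [opTensor_coe]
  change ((TensorProduct.mapL (.id ℂ H) (.id ℂ K) x : H ⊗[ℂ] K) : HilbertTensor H K) = x
  rw [TensorProduct.mapL_id_id]
  rfl

lemma opTensor_add_left (S S' : H →L[ℂ] H) (T : K →L[ℂ] K) :
    opTensor (S + S') T = opTensor S T + opTensor S' T := by
  refine hilbertTensor_ext fun x => ?_
  rw [add_apply, opTensor_coe, opTensor_coe, opTensor_coe,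
    TensorProduct.mapL_add_left, ← UniformSpace.Completion.coe_add]
  rfl

lemma opTensor_add_right (S : H →L[ℂ] H) (T T' : K →L[ℂ] K) :
    opTensor S (T + T') = opTensor S T + opTensor S T' := by
  refine hilbertTensor_ext fun x => ?_
  rw [add_apply, opTensor_coe, opTensor_coe, opTensor_coe,
    TensorProduct.mapL_add_right, ← UniformSpace.Completion.coe_add]
  rfl

lemma opTensor_smul_left (c : ℂ) (S : H →L[ℂ] H) (T : K →L[ℂ] K) :
    opTensor (c • S) T = c • opTensor S T := by
  refine hilbertTensor_ext fun x => ?_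
  rw [smul_apply, opTensor_coe, opTensor_coe,
    TensorProduct.mapL_smul_left, ← UniformSpace.Completion.coe_smul]
  rfl

lemma opTensor_smul_right (c : ℂ) (S : H →L[ℂ] H) (T : K →L[ℂ] K) :
    opTensor S (c • T) = c • opTensor S T := by
  refine hilbertTensor_ext fun x => ?_
  rw [smul_apply, opTensor_coe, opTensor_coe,
    TensorProduct.mapL_smul_right, ← UniformSpace.Completion.coe_smul]
  rfl

lemma opTensor_star [CompleteSpace H] [CompleteSpace K] (S : H →L[ℂ] H) (T : K →L[ℂ] K) :
    opTensor (star S) (star T) = star (opTensor S T) := by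
  refine (ContinuousLinearMap.eq_adjoint_iff _ _).mpr fun x y => ?_
  induction x, y using UniformSpace.Completion.induction_on₂ with
  | hp => apply isClosed_eq <;> fun_prop
  | ih x y =>
    rw [opTensor_coe, opTensor_coe, UniformSpace.Completion.inner_coe,
      UniformSpace.Completion.inner_coe]
    induction x with
    | zero => simp
    | add x x' hx hx' => rw [map_add, inner_add_left, inner_add_left, hx, hx']
    | tmul a b =>
      induction y with
      | zero => simp
      | add y y' hy hy' => rw [map_add, inner_add_right, inner_add_right, hy, hy']
      | tmul c d =>
        rw [TensorProduct.mapL_tmul, TensorProduct.mapL_tmul, TensorProduct.inner_tmul,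
          TensorProduct.inner_tmul, ContinuousLinearMap.star_eq_adjoint,
          ContinuousLinearMap.star_eq_adjoint, ContinuousLinearMap.adjoint_inner_left,
          ContinuousLinearMap.adjoint_inner_left]

end Operators

variable {A B : Type} [CStarAlgebra A] [CStarAlgebra B]

/-- The representation `π₁ ⊗ π₂` of the algebraic tensor product as an algebra homomorphism. -/
noncomputable def StarRep.algTensorHom (ρ : StarRep A) (σ : StarRep B) :
    A ⊗[ℂ] B →ₐ[ℂ] (HilbertTensor ρ.H σ.H →L[ℂ] HilbertTensor ρ.H σ.H) :=
  Algebra.TensorProduct.algHomOfLinearMapTensorProduct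
    (TensorProduct.lift (LinearMap.mk₂ ℂ (fun a b => opTensor (ρ.π a) (σ.π b))
      (fun a a' b => by rw [map_add, opTensor_add_left])
      (fun c a b => by rw [map_smul, opTensor_smul_left])
      (fun a b b' => by rw [map_add, opTensor_add_right])
      (fun c a b => by rw [map_smul, opTensor_smul_right])))
    (fun a a' b b' => by
      simp only [TensorProduct.lift.tmul, LinearMap.mk₂_apply, map_mul, opTensor_mul])
    (by simp only [TensorProduct.lift.tmul, LinearMap.mk₂_apply, map_one, opTensor_one])

lemma StarRep.algTensorHom_tmul (ρ : StarRep A) (σ : StarRep B) (a : A) (b : B) :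
    ρ.algTensorHom σ (a ⊗ₜ[ℂ] b) = opTensor (ρ.π a) (σ.π b) := rfl

/-- The representation `π₁ ⊗ π₂` of the algebraic tensor product,
`a ⊗ b ↦ π₁(a) ⊗ π₂(b)`. -/
noncomputable def StarRep.algTensor (ρ : StarRep A) (σ : StarRep B) :
    A ⊗[ℂ] B →⋆ₐ[ℂ] (HilbertTensor ρ.H σ.H →L[ℂ] HilbertTensor ρ.H σ.H) :=
  { ρ.algTensorHom σ with
    map_star' := fun x => by
      change ρ.algTensorHom σ (star x) = star (ρ.algTensorHom σ x)
      induction x with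
      | zero => rw [star_zero, map_zero]; exact (star_zero (HilbertTensor ρ.H σ.H →L[ℂ] HilbertTensor ρ.H σ.H)).symm
      | add x y hx hy => rw [star_add, map_add, map_add, hx, hy]; exact (star_add (R := HilbertTensor ρ.H σ.H →L[ℂ] HilbertTensor ρ.H σ.H) _ _).symm
      | tmul a b =>
        rw [TensorProduct.star_tmul, algTensorHom_tmul, algTensorHom_tmul, map_star, map_star,
          opTensor_star] }

lemma StarRep.algTensor_tmul (ρ : StarRep A) (σ : StarRep B) (a : A) (b : B) :
    ρ.algTensor σ (a ⊗ₜ[ℂ] b) = opTensor (ρ.π a) (σ.π b) := rfl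

/-- The embedding `a ↦ a ⊗ 1`. -/
noncomputable def includeLeftStar (A B : Type) [CStarAlgebra A] [CStarAlgebra B] :
    A →⋆ₐ[ℂ] A ⊗[ℂ] B :=
  { (Algebra.TensorProduct.includeLeft : A →ₐ[ℂ] A ⊗[ℂ] B) with
    map_star' := fun a => by
      change star a ⊗ₜ[ℂ] (1 : B) = star (a ⊗ₜ[ℂ] (1 : B))
      rw [TensorProduct.star_tmul, star_one] }

/-- The embedding `b ↦ 1 ⊗ b`. -/
noncomputable def includeRightStar (A B : Type) [CStarAlgebra A] [CStarAlgebra B] :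
    B →⋆ₐ[ℂ] A ⊗[ℂ] B :=
  { (Algebra.TensorProduct.includeRight : B →ₐ[ℂ] A ⊗[ℂ] B) with
    map_star' := fun b => by
      change (1 : A) ⊗ₜ[ℂ] star b = star ((1 : A) ⊗ₜ[ℂ] b)
      rw [TensorProduct.star_tmul, star_one] }

/-- The C⋆-seminorm `x ↦ ‖(π₁ ⊗ π₂)(x)‖` on the algebraic tensor product. -/
noncomputable def StarRep.tensorSeminorm (ρ : StarRep A) (σ : StarRep B) :
    CStarSeminorm (A ⊗[ℂ] B) :=
  CStarSeminorm.ofHom (C := HilbertTensor ρ.H σ.H →L[ℂ] HilbertTensor ρ.H σ.H) (ρ.algTensor σ)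

lemma algTensor_bddAbove (x : A ⊗[ℂ] B) :
    BddAbove (Set.range fun r : StarRep A × StarRep B =>
      (r.1.tensorSeminorm r.2).toFun x) := by
  have key : ∃ c : ℝ, ∀ r : StarRep A × StarRep B,
      (r.1.tensorSeminorm r.2).toFun x ≤ c := by
    induction x with
    | zero => exact ⟨0, fun r => (CStarSeminorm.apply_zero _).le⟩
    | add x y hx hy =>
      obtain ⟨c, hc⟩ := hx
      obtain ⟨d, hd⟩ := hy
      exact ⟨c + d, fun r => (CStarSeminorm.add_le' _ x y).trans (add_le_add (hc r) (hd r))⟩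
    | tmul a b =>
      refine ⟨‖a‖ * ‖b‖, fun r => ?_⟩
      have h : a ⊗ₜ[ℂ] b = (a ⊗ₜ[ℂ] (1 : B)) * ((1 : A) ⊗ₜ[ℂ] b) := by simp
      rw [h]
      refine (CStarSeminorm.mul_le' _ _ _).trans
        (mul_le_mul ?_ ?_ (CStarSeminorm.apply_nonneg _ _) (norm_nonneg _))
      · exact NonUnitalStarAlgHom.norm_apply_le ((r.1.algTensor r.2).comp
          (includeLeftStar A B)) a
      · exact NonUnitalStarAlgHom.norm_apply_le ((r.1.algTensor r.2).comp
          (includeRightStar A B)) b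
  obtain ⟨c, hc⟩ := key
  exact ⟨c, by rintro _ ⟨r, rfl⟩; exact hc r⟩

/-- The minimal (spatial) C⋆-norm on the algebraic tensor product of two C⋆-algebras: the supremum
of `‖(π₁ ⊗ π₂)(x)‖` over all representations `π₁` of `A` and `π₂` of `B`. -/
noncomputable def minNorm (A B : Type) [CStarAlgebra A] [CStarAlgebra B] :
    CStarSeminorm (A ⊗[ℂ] B) :=
  CStarSeminorm.iSup (fun r : StarRep A × StarRep B => r.1.tensorSeminorm r.2)
    algTensor_bddAbove

/-- The minimal C⋆-tensor product. -/
def MinTensor (A B : Type) [CStarAlgebra A] [CStarAlgebra B] : Type :=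
  (minNorm A B).Completion

noncomputable instance (A B : Type) [CStarAlgebra A] [CStarAlgebra B] :
    CStarAlgebra (MinTensor A B) :=
  inferInstanceAs (CStarAlgebra (minNorm A B).Completion)

/-- The canonical map of the algebraic tensor product into the minimal C⋆-tensor product. -/
noncomputable def MinTensor.of (A B : Type) [CStarAlgebra A] [CStarAlgebra B] :
    A ⊗[ℂ] B →⋆ₐ[ℂ] MinTensor A B :=
  (minNorm A B).of

/-- The tensor product `π₁ ⊗ π₂` of two representations, the representation of the minimal
C⋆-tensor product with `a ⊗ b ↦ π₁(a) ⊗ π₂(b)`. -/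
noncomputable def StarRep.tensor (ρ : StarRep A) (σ : StarRep B) : StarRep (MinTensor A B) where
  H := HilbertTensor ρ.H σ.H
  π := (minNorm A B).lift (C := HilbertTensor ρ.H σ.H →L[ℂ] HilbertTensor ρ.H σ.H)
    (ρ.algTensor σ) fun x => le_ciSup (algTensor_bddAbove x) (ρ, σ)

lemma StarRep.tensor_of (ρ : StarRep A) (σ : StarRep B) (x : A ⊗[ℂ] B) :
    (ρ.tensor σ).π (MinTensor.of A B x) =
      (ρ.algTensor σ x : HilbertTensor ρ.H σ.H →L[ℂ] HilbertTensor ρ.H σ.H) :=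
  (minNorm A B).lift_of (C := HilbertTensor ρ.H σ.H →L[ℂ] HilbertTensor ρ.H σ.H) _ _ _

/-- The extension of a linear isometric equivalence to the completions. -/
noncomputable def completionIsometryEquiv {E F : Type} [NormedAddCommGroup E]
    [InnerProductSpace ℂ E] [NormedAddCommGroup F] [InnerProductSpace ℂ F] (W : E ≃ₗᵢ[ℂ] F) :
    UniformSpace.Completion E ≃ₗᵢ[ℂ] UniformSpace.Completion F where
  toFun := (W : E →L[ℂ] F).completion
  invFun := (W.symm : F →L[ℂ] E).completion
  map_add' := map_add _
  map_smul' := map_smul _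
  left_inv x := by
    induction x using UniformSpace.Completion.induction_on with
    | hp => exact isClosed_eq (by fun_prop) continuous_id
    | ih x =>
      rw [ContinuousLinearMap.completion_apply_coe, ContinuousLinearMap.completion_apply_coe]
      exact congrArg _ (W.symm_apply_apply x)
  right_inv x := by
    induction x using UniformSpace.Completion.induction_on with
    | hp => exact isClosed_eq (by fun_prop) continuous_id
    | ih x =>
      rw [ContinuousLinearMap.completion_apply_coe, ContinuousLinearMap.completion_apply_coe]
      exact congrArg _ (W.apply_symm_apply x)
  norm_map' x := by
    change ‖(W : E →L[ℂ] F).completion x‖ = ‖x‖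
    induction x using UniformSpace.Completion.induction_on with
    | hp => exact isClosed_eq (by fun_prop) (by fun_prop)
    | ih x =>
      rw [ContinuousLinearMap.completion_apply_coe, UniformSpace.Completion.norm_coe,
        UniformSpace.Completion.norm_coe]
      exact W.norm_map x

lemma completionIsometryEquiv_coe {E F : Type} [NormedAddCommGroup E]
    [InnerProductSpace ℂ E] [NormedAddCommGroup F] [InnerProductSpace ℂ F] (W : E ≃ₗᵢ[ℂ] F)
    (x : E) : completionIsometryEquiv W (x : UniformSpace.Completion E) = (W x : F) :=
  ContinuousLinearMap.completion_apply_coe _ _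

lemma StarRep.UnitaryEquiv.comp {ρ σ : StarRep A} (h : ρ.UnitaryEquiv σ) (f : B →⋆ₐ[ℂ] A) :
    (ρ.comp f).UnitaryEquiv (σ.comp f) := by
  obtain ⟨U, hU⟩ := h
  exact ⟨U, fun b x => hU (f b) x⟩

lemma StarRep.tensor_continuous (ρ : StarRep A) (σ : StarRep B) :
    Continuous (fun x : MinTensor A B =>
      ((ρ.tensor σ).π x : HilbertTensor ρ.H σ.H →L[ℂ] HilbertTensor ρ.H σ.H)) :=
  (minNorm A B).continuous_lift (C := HilbertTensor ρ.H σ.H →L[ℂ] HilbertTensor ρ.H σ.H) _ _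

lemma StarRep.algTensor_intertwine {ρ ρ' : StarRep A} {σ σ' : StarRep B}
    (U : ρ.H ≃ₗᵢ[ℂ] ρ'.H) (hU : ∀ a x, U (ρ.π a x) = ρ'.π a (U x))
    (V : σ.H ≃ₗᵢ[ℂ] σ'.H) (hV : ∀ b x, V (σ.π b x) = σ'.π b (V x))
    (x : A ⊗[ℂ] B) (v : HilbertTensor ρ.H σ.H) :
    completionIsometryEquiv (TensorProduct.congrIsometry U V) (ρ.algTensorHom σ x v) =
      ρ'.algTensorHom σ' x (completionIsometryEquiv (TensorProduct.congrIsometry U V) v) := by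
  induction x with
  | zero => simp only [map_zero, zero_apply]
  | add x y hx hy => simp only [map_add, add_apply, hx, hy]
  | tmul a b =>
    rw [algTensorHom_tmul, algTensorHom_tmul]
    induction v using UniformSpace.Completion.induction_on with
    | hp => exact isClosed_eq (by fun_prop) (by fun_prop)
    | ih v =>
      rw [opTensor_coe, completionIsometryEquiv_coe, completionIsometryEquiv_coe, opTensor_coe]
      congr 1
      induction v with
      | zero => simp only [map_zero]
      | add v w hv hw => rw [map_add, map_add, map_add, map_add, hv, hw]
      | tmul v w =>
        rw [TensorProduct.mapL_tmul]
        change U (ρ.π a v) ⊗ₜ[ℂ] V (σ.π b w) = ρ'.π a (U v) ⊗ₜ[ℂ] σ'.π b (V w)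
        rw [hU, hV]

lemma StarRep.tensor_congr {ρ ρ' : StarRep A} {σ σ' : StarRep B}
    (h : ρ.UnitaryEquiv ρ') (h' : σ.UnitaryEquiv σ') :
    (ρ.tensor σ).UnitaryEquiv (ρ'.tensor σ') := by
  obtain ⟨U, hU⟩ := h
  obtain ⟨V, hV⟩ := h'
  refine ⟨completionIsometryEquiv (TensorProduct.congrIsometry U V), fun x v => ?_⟩
  refine (minNorm A B).denseRange_of.induction_on (p := fun x : MinTensor A B =>
    completionIsometryEquiv (TensorProduct.congrIsometry U V)
      (((ρ.tensor σ).π x : HilbertTensor ρ.H σ.H →L[ℂ] HilbertTensor ρ.H σ.H) v) =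
    ((ρ'.tensor σ').π x : HilbertTensor ρ'.H σ'.H →L[ℂ] HilbertTensor ρ'.H σ'.H)
      (completionIsometryEquiv (TensorProduct.congrIsometry U V) v)) x ?_ (fun y => ?_)
  · have h1 := ρ.tensor_continuous σ
    have h2 := ρ'.tensor_continuous σ'
    exact isClosed_eq ((LinearIsometryEquiv.continuous _).comp (h1.clm_apply continuous_const))
      (h2.clm_apply continuous_const)
  · have h1 := ρ.tensor_of σ y
    have h2 := ρ'.tensor_of σ' y
    change completionIsometryEquiv (TensorProduct.congrIsometry U V)
      (((ρ.tensor σ).π (MinTensor.of A B y) :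
        HilbertTensor ρ.H σ.H →L[ℂ] HilbertTensor ρ.H σ.H) v) =
      ((ρ'.tensor σ').π (MinTensor.of A B y) :
        HilbertTensor ρ'.H σ'.H →L[ℂ] HilbertTensor ρ'.H σ'.H)
      (completionIsometryEquiv (TensorProduct.congrIsometry U V) v)
    rw [h1, h2]
    exact algTensor_intertwine U hU V hV y v

end Tensor

section Kronecker

open scoped TensorProduct Matrix.Norms.L2Operator

/-- The bijection `J ↦ (J', J'')` between tuples in `{0, …, nm - 1}` and pairs of tuples in
`{0, …, n - 1}` and `{0, …, m - 1}`, where `j_i = m j_i' + j_i''`. -/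
def digitEquiv (n m k : ℕ) : (Fin k → Fin (n * m)) ≃ (Fin k → Fin n) × (Fin k → Fin m) where
  toFun J := (fun i => (finProdFinEquiv.symm (J i)).1, fun i => (finProdFinEquiv.symm (J i)).2)
  invFun P := fun i => finProdFinEquiv (P.1 i, P.2 i)
  left_inv J := by funext i; exact finProdFinEquiv.apply_symm_apply (J i)
  right_inv P := by simp

lemma digitEquiv_symm_val (n m k : ℕ) (P : (Fin k → Fin n) × (Fin k → Fin m)) (i : Fin k) :
    (((digitEquiv n m k).symm P i : Fin (n * m)) : ℕ) = m * P.1 i + P.2 i :=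
  add_comm _ _

/-- The Kronecker coproduct `M_{nm}^{⊗ k} ≃ M_n^{⊗ k} ⊗ M_m^{⊗ k}`, the inverse of the Kronecker
product; on matrix units it is `E_{J,K} ↦ E_{J',K'} ⊗ E_{J'',K''}`. -/
noncomputable def kronCoproduct (n m k : ℕ) : MatPow (n * m) k ≃⋆ₐ[ℂ] MatPow n k ⊗[ℂ] MatPow m k :=
  (StarAlgEquiv.ofAlgEquiv (Matrix.reindexAlgEquiv ℂ ℂ (digitEquiv n m k))
    (fun _ => rfl)).trans (Matrix.kroneckerStarAlgEquiv _ _ ℂ).symm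

lemma kronCoproduct_symm_tmul (n m k : ℕ) (M : MatPow n k) (N : MatPow m k)
    (J K : Fin k → Fin (n * m)) :
    (kronCoproduct n m k).symm (M ⊗ₜ N) J K =
      M (digitEquiv n m k J).1 (digitEquiv n m k K).1 *
        N (digitEquiv n m k J).2 (digitEquiv n m k K).2 :=
  rfl

lemma kronCoproduct_single (n m k : ℕ) (J K : Fin k → Fin (n * m)) :
    kronCoproduct n m k (Matrix.single J K 1) =
      Matrix.single (digitEquiv n m k J).1 (digitEquiv n m k K).1 1 ⊗ₜ
        Matrix.single (digitEquiv n m k J).2 (digitEquiv n m k K).2 1 := by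
  rw [← StarAlgEquiv.eq_symm_apply]
  ext P Q
  rw [kronCoproduct_symm_tmul]
  have hinj : ∀ J P : Fin k → Fin (n * m), J = P ↔
      (digitEquiv n m k J).1 = (digitEquiv n m k P).1 ∧
        (digitEquiv n m k J).2 = (digitEquiv n m k P).2 := fun J P => by
    rw [← Prod.ext_iff, EmbeddingLike.apply_eq_iff_eq]
  simp only [Matrix.single_apply, hinj J P, hinj K Q]
  split_ifs <;> simp_all

/-- The tensor product of two ⋆-homomorphisms between algebraic tensor products. -/
noncomputable def starTensorMap {A B C D : Type} [Ring A] [StarRing A] [Algebra ℂ A]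
    [StarModule ℂ A] [Ring B] [StarRing B] [Algebra ℂ B] [StarModule ℂ B] [Ring C] [StarRing C]
    [Algebra ℂ C] [StarModule ℂ C] [Ring D] [StarRing D] [Algebra ℂ D] [StarModule ℂ D]
    (f : A →⋆ₐ[ℂ] C) (g : B →⋆ₐ[ℂ] D) : A ⊗[ℂ] B →⋆ₐ[ℂ] C ⊗[ℂ] D :=
  { Algebra.TensorProduct.map f.toAlgHom g.toAlgHom with
    map_star' := fun x => by
      change Algebra.TensorProduct.map f.toAlgHom g.toAlgHom (star x) =
        star (Algebra.TensorProduct.map f.toAlgHom g.toAlgHom x)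
      induction x with
      | zero => rw [star_zero, map_zero, star_zero]
      | add x y hx hy => rw [star_add, map_add, map_add, hx, hy, star_add]
      | tmul a b =>
        rw [TensorProduct.star_tmul, Algebra.TensorProduct.map_tmul,
          Algebra.TensorProduct.map_tmul, TensorProduct.star_tmul]
        exact congrArg₂ _ (map_star f a) (map_star g b) }

lemma starTensorMap_tmul {A B C D : Type} [Ring A] [StarRing A] [Algebra ℂ A]
    [StarModule ℂ A] [Ring B] [StarRing B] [Algebra ℂ B] [StarModule ℂ B] [Ring C] [StarRing C]
    [Algebra ℂ C] [StarModule ℂ C] [Ring D] [StarRing D] [Algebra ℂ D] [StarModule ℂ D]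
    (f : A →⋆ₐ[ℂ] C) (g : B →⋆ₐ[ℂ] D) (a : A) (b : B) :
    starTensorMap f g (a ⊗ₜ[ℂ] b) = f a ⊗ₜ[ℂ] g b := rfl

lemma starTensorMap_comp {A B C D E F : Type} [Ring A] [StarRing A] [Algebra ℂ A]
    [StarModule ℂ A] [Ring B] [StarRing B] [Algebra ℂ B] [StarModule ℂ B] [Ring C] [StarRing C]
    [Algebra ℂ C] [StarModule ℂ C] [Ring D] [StarRing D] [Algebra ℂ D] [StarModule ℂ D]
    [Ring E] [StarRing E] [Algebra ℂ E] [StarModule ℂ E] [Ring F] [StarRing F] [Algebra ℂ F]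
    [StarModule ℂ F] (f : A →⋆ₐ[ℂ] C) (g : B →⋆ₐ[ℂ] D) (f' : C →⋆ₐ[ℂ] E) (g' : D →⋆ₐ[ℂ] F)
    (f'' : A →⋆ₐ[ℂ] E) (g'' : B →⋆ₐ[ℂ] F) (hf : ∀ a, f' (f a) = f'' a)
    (hg : ∀ b, g' (g b) = g'' b) (x : A ⊗[ℂ] B) :
    starTensorMap f' g' (starTensorMap f g x) = starTensorMap f'' g'' x := by
  induction x with
  | zero => simp only [map_zero]
  | add x y hx hy => rw [map_add, map_add, map_add, hx, hy]
  | tmul a b => rw [starTensorMap_tmul, starTensorMap_tmul, starTensorMap_tmul, hf, hg]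

variable (n m : ℕ) [NeZero n] [NeZero m]

/-- The restriction of `φ` to the finite stage `M_{nm}^{⊗ k}`. -/
noncomputable def phiStage (k : ℕ) : MatPow (n * m) k →⋆ₐ[ℂ] MinTensor (UHF n) (UHF m) :=
  ((MinTensor.of (UHF n) (UHF m)).comp (starTensorMap (UHF.of n k) (UHF.of m k))).comp
    (kronCoproduct n m k : MatPow (n * m) k →⋆ₐ[ℂ] MatPow n k ⊗[ℂ] MatPow m k)

lemma phiStage_apply (k : ℕ) (M : MatPow (n * m) k) :
    phiStage n m k M = MinTensor.of (UHF n) (UHF m)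
      (starTensorMap (UHF.of n k) (UHF.of m k) (kronCoproduct n m k M)) := rfl

lemma matPowEmbed_kron (n m k l : ℕ) (h : k ≤ l) (x : MatPow n k ⊗[ℂ] MatPow m k) :
    matPowEmbed (n * m) k l h ((kronCoproduct n m k).symm x) =
      (kronCoproduct n m l).symm
        (starTensorMap (matPowEmbed n k l h) (matPowEmbed m k l h) x) := by
  induction x with
  | zero => simp only [map_zero]
  | add x y hx hy => simp only [map_add, hx, hy]
  | tmul M N =>
    ext J K
    rw [starTensorMap_tmul, kronCoproduct_symm_tmul, matPowEmbed_apply, matPowEmbed_apply,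
      matPowEmbed_apply]
    have ht : TailEq k J K ↔
        TailEq k (digitEquiv n m l J).1 (digitEquiv n m l K).1 ∧
          TailEq k (digitEquiv n m l J).2 (digitEquiv n m l K).2 := by
      refine ⟨fun hJK => ⟨fun i hi => ?_, fun i hi => ?_⟩, fun hJK i hi => ?_⟩
      · exact congrArg (fun a => (finProdFinEquiv.symm a).1) (hJK i hi)
      · exact congrArg (fun a => (finProdFinEquiv.symm a).2) (hJK i hi)
      · exact finProdFinEquiv.symm.injective (Prod.ext (hJK.1 i hi) (hJK.2 i hi))
    by_cases h1 : TailEq k (digitEquiv n m l J).1 (digitEquiv n m l K).1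
    · by_cases h2 : TailEq k (digitEquiv n m l J).2 (digitEquiv n m l K).2
      · rw [if_pos (ht.mpr ⟨h1, h2⟩), if_pos h1, if_pos h2]
        rfl
      · rw [if_neg (fun h' => h2 (ht.mp h').2), if_neg h2, mul_zero]
    · rw [if_neg (fun h' => h1 (ht.mp h').1), if_neg h1, zero_mul]

lemma phiStage_compat (k l : ℕ) (h : k ≤ l) (M : MatPow (n * m) k) :
    phiStage n m l (matPowEmbed (n * m) k l h M) = phiStage n m k M := by
  obtain ⟨x, rfl⟩ : ∃ x, (kronCoproduct n m k).symm x = M :=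
    ⟨kronCoproduct n m k M, StarAlgEquiv.symm_apply_apply _ _⟩
  rw [matPowEmbed_kron]
  rw [phiStage_apply, phiStage_apply, StarAlgEquiv.apply_symm_apply,
    StarAlgEquiv.apply_symm_apply]
  exact congrArg _ (starTensorMap_comp _ _ _ _ _ _ (UHF.of_embed n k l h) (UHF.of_embed m k l h) x)

/-- The ⋆-homomorphism `φ : UHF_{nm} → UHF_n ⊗ UHF_m` which is the Kronecker coproduct on every
finite stage. -/
noncomputable def phi : UHF (n * m) →⋆ₐ[ℂ] MinTensor (UHF n) (UHF m) :=
  UHF.lift (n * m) (phiStage n m) (phiStage_compat n m)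

lemma phi_of (k : ℕ) (M : MatPow (n * m) k) :
    phi n m (UHF.of (n * m) k M) = MinTensor.of (UHF n) (UHF m)
      (starTensorMap (UHF.of n k) (UHF.of m k) (kronCoproduct n m k M)) :=
  UHF.lift_of _ _ _ _ _

variable {n m}

/-- The tensor product `π₁ ⊗_φ π₂ = (π₁ ⊗ π₂) ∘ φ`. -/
noncomputable def StarRep.ptimes (ρ : StarRep (UHF n)) (σ : StarRep (UHF m)) :
    StarRep (UHF (n * m)) :=
  (ρ.tensor σ).comp (phi n m)

lemma StarRep.ptimes_congr {ρ ρ' : StarRep (UHF n)} {σ σ' : StarRep (UHF m)}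
    (h : ρ.UnitaryEquiv ρ') (h' : σ.UnitaryEquiv σ') :
    (ρ.ptimes σ).UnitaryEquiv (ρ'.ptimes σ') :=
  (StarRep.tensor_congr h h').comp (phi n m)

/-- The operation `⊗_φ` on unitary equivalence classes. -/
noncomputable def RepClass.ptimes (P : RepClass (UHF n)) (Q : RepClass (UHF m)) :
    RepClass (UHF (n * m)) :=
  Quotient.map₂ StarRep.ptimes (fun _ _ h _ _ h' => StarRep.ptimes_congr h h') P Q

/-- The GNS representation `π_{T(J)}` of `UHF_n` by the state `ω_{T(J)}`. -/
noncomputable def uhfRep (n : ℕ) [NeZero n] (J : ℕ → Fin n) : StarRep (UHF n) :=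
  StarRep.gns (uhfState n J)

/-- The unitary equivalence class `P_n[J]` of `π_{T(J)}`. -/
noncomputable def uhfClass (n : ℕ) [NeZero n] (J : ℕ → Fin n) : RepClass (UHF n) :=
  Quotient.mk _ (uhfRep n J)

/-- Tail equivalence of sequences. -/
def TailEquiv {α : Type*} (J J' : ℕ → α) : Prop := ∃ r₀ : ℕ, ∀ r ≥ r₀, J r = J' r

/-- The sequence `(J ⋆ K)_l = m j_l + k_l` in `{0, …, nm - 1}`. With entries numbered from `1`
instead of `0` this is `m (j_l - 1) + k_l`. -/
def seqStar {n m : ℕ} (J : ℕ → Fin n) (K : ℕ → Fin m) : ℕ → Fin (n * m) :=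
  fun l => finProdFinEquiv (J l, K l)

lemma seqStar_val {n m : ℕ} (J : ℕ → Fin n) (K : ℕ → Fin m) (l : ℕ) :
    ((seqStar J K l : Fin (n * m)) : ℕ) = m * J l + K l :=
  add_comm _ _

end Kronecker

/-! ### Cyclic vectors and uniqueness of the GNS representation -/

section CyclicVectors

open scoped ComplexOrder InnerProductSpace
open UniformSpace

variable {A : Type} [CStarAlgebra A]

/-! Everything is reduced to one notion: a cyclic vector `Ω` whose vector functional is `ω_J`. The
GNS representation has one, and any representation having one is unitarily equivalent to `π_J`
(`StarRep.IsGNSVector.gns_unitaryEquiv`). Each claim thus becomes a statement about the existence of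
such vectors.

The main tool is the sequence of projections `p_k = E_{j_1,j_1} ⊗ ⋯ ⊗ E_{j_k,j_k}`. They fix `Ω`,
and compressing a matrix of a stage up to `k` by `p_k` gives a scalar multiple of `p_k`. Hence
`σ(p_k)` converges strongly to the rank-one projection onto `ℂΩ` (`tendsto_uhfProj`). A closed
invariant subspace therefore either contains `Ω`, and is everything by cyclicity, or is orthogonal
to the orbit of `Ω`, and is zero. This is (i).

For (ii), suppose that one space carries cyclic vectors `Ω` for `ω_J` and `Ω'` for `ω_{J'}`. If `J`
and `J'` differ at arbitrarily late positions, then late projections along `J` kill every `σ(M)Ω'`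
with `M` in a fixed stage, yet fix `Ω`. This contradicts the density of such vectors. Conversely, if
the tails agree from `r` on, the matrix unit taking the initial segment of `J` to that of `J'` moves
`Ω` to a vector for `ω_{J'}`, which is cyclic by irreducibility.

For (iii), `Ω ⊗ Ω'` is a cyclic vector for `ω_{J⋆K}`: a diagonal entry of a Kronecker product is the
product of the diagonal entries of its factors. -/

lemma StarRep.inner_star_apply (σ : StarRep A) (a : A) (x y : σ.H) :
    ⟪σ.π (star a) x, y⟫_ℂ = ⟪x, σ.π a y⟫_ℂ := by
  rw [map_star, ContinuousLinearMap.star_eq_adjoint, ContinuousLinearMap.adjoint_inner_left]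

lemma StarRep.π_mul_apply (σ : StarRep A) (a b : A) (x : σ.H) :
    σ.π (a * b) x = σ.π a (σ.π b x) := by
  rw [map_mul]; rfl

lemma StarRep.π_one_apply (σ : StarRep A) (x : σ.H) : σ.π 1 x = x := by
  rw [map_one]; rfl

lemma StarRep.norm_π_le (σ : StarRep A) (a : A) : ‖σ.π a‖ ≤ ‖a‖ :=
  NonUnitalStarAlgHom.norm_apply_le σ.π a

lemma StarRep.norm_π_apply_le (σ : StarRep A) (a : A) (x : σ.H) : ‖σ.π a x‖ ≤ ‖a‖ * ‖x‖ :=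
  ((σ.π a).le_opNorm x).trans (mul_le_mul_of_nonneg_right (σ.norm_π_le a) (norm_nonneg x))

lemma StarRep.continuous_π_apply (σ : StarRep A) (x : σ.H) : Continuous fun a => σ.π a x :=
  AddMonoidHomClass.continuous_of_bound
    ((ContinuousLinearMap.apply ℂ σ.H x).toLinearMap ∘ₗ σ.π.toAlgHom.toLinearMap) ‖x‖
    fun a => (σ.norm_π_apply_le a x).trans_eq (mul_comm _ _)

/-- The vector `Ω` is cyclic for `σ` and its vector functional is `f`. -/
structure StarRep.IsGNSVector (σ : StarRep A) [PartialOrder A] (f : A →ₚ[ℂ] ℂ) (Ω : σ.H) : Prop where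
  inner_eq : ∀ a, ⟪Ω, σ.π a Ω⟫_ℂ = f a
  dense : DenseRange fun a => σ.π a Ω

variable [PartialOrder A] [StarOrderedRing A]

lemma PositiveLinearMap.gnsStarAlgHom_apply_coe (f : A →ₚ[ℂ] ℂ) (a : A) (b : f.PreGNS) :
    f.gnsStarAlgHom a (b : f.GNS) = (f.toPreGNS (a * f.ofPreGNS b) : f.PreGNS) :=
  f.gnsNonUnitalStarAlgHom_apply_coe

/-- The vector is the class of `1`: since `a * 1 = a`, its orbit is the image of the algebra in its
own completion. -/
lemma StarRep.exists_isGNSVector_gns (f : A →ₚ[ℂ] ℂ) :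
    ∃ Ω, (StarRep.gns f).IsGNSVector f Ω := by
  have key : ∀ a : A, f.gnsStarAlgHom a ((f.toPreGNS 1 : f.PreGNS) : f.GNS) =
      ((f.toPreGNS a : f.PreGNS) : f.GNS) := fun a => by
    rw [f.gnsStarAlgHom_apply_coe, PositiveLinearMap.ofPreGNS_toPreGNS, mul_one]
  refine ⟨((f.toPreGNS 1 : f.PreGNS) : f.GNS), fun a => ?_, ?_⟩
  · change ⟪((f.toPreGNS 1 : f.PreGNS) : f.GNS), f.gnsStarAlgHom a _⟫_ℂ = _
    rw [key, Completion.inner_coe, PositiveLinearMap.preGNS_inner_def]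
    simp
  · change DenseRange fun a => f.gnsStarAlgHom a ((f.toPreGNS 1 : f.PreGNS) : f.GNS)
    simp_rw [key]
    exact Completion.denseRange_coe (α := f.PreGNS)

/-- Since `‖σ(a)Ω‖² = f(a* a)`, the map `a ↦ σ(a)Ω` is isometric for the GNS seminorm. It extends to
the completion and intertwines the actions. -/
lemma StarRep.IsGNSVector.gns_unitaryEquiv {σ : StarRep A} {f : A →ₚ[ℂ] ℂ} {Ω : σ.H}
    (h : σ.IsGNSVector f Ω) : (StarRep.gns f).UnitaryEquiv σ := by
  let L : f.PreGNS →ₗᵢ[ℂ] σ.H :=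
    { toFun := fun a => σ.π (f.ofPreGNS a) Ω
      map_add' := fun a b => by rw [map_add, map_add]; rfl
      map_smul' := fun c a => by rw [map_smul, map_smul]; rfl
      norm_map' := fun a => by
        change ‖σ.π (f.ofPreGNS a) Ω‖ = ‖a‖
        -- The norms are compared through their squares, cast to `ℂ`, where `f` takes its values.
        rw [← sq_eq_sq₀ (norm_nonneg _) (norm_nonneg _), ← Complex.ofReal_inj]
        push_cast
        rw [PositiveLinearMap.preGNS_norm_sq, ← h.inner_eq, σ.π_mul_apply,
          ← σ.inner_star_apply, star_star]
        exact (inner_self_eq_norm_sq_to_K (𝕜 := ℂ) (σ.π (f.ofPreGNS a) Ω)).symm }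
  let E : f.GNS →L[ℂ] σ.H := L.toContinuousLinearMap.extend (Completion.toComplL : f.PreGNS →L[ℂ] f.GNS)
  have hE : ∀ a : f.PreGNS, E (a : f.GNS) = σ.π (f.ofPreGNS a) Ω := fun a =>
    ContinuousLinearMap.extend_eq _ Completion.denseRange_coe
      (Completion.isUniformInducing_coe _) a
  have hnorm : ∀ x, ‖E x‖ = ‖x‖ := fun x => by
    induction x using Completion.induction_on with
    | hp => exact isClosed_eq (by fun_prop) (by fun_prop)
    | ih a => rw [hE, Completion.norm_coe]; exact L.norm_map a
  let E' : f.GNS →ₗᵢ[ℂ] σ.H := ⟨E.toLinearMap, hnorm⟩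
  have hsurj : Function.Surjective E' := by
    -- An isometry from a complete space has closed range, and this range contains the dense orbit
    -- of `Ω`.
    rw [← Set.range_eq_univ, ← E'.isometry.isClosedEmbedding.isClosed_range.closure_eq]
    refine Dense.closure_eq (h.dense.mono ?_)
    rintro _ ⟨a, rfl⟩
    exact ⟨((f.toPreGNS a : f.PreGNS) : f.GNS), hE _⟩
  refine ⟨LinearIsometryEquiv.ofSurjective E' hsurj, fun a x => ?_⟩
  change E (f.gnsStarAlgHom a x) = σ.π a (E x)
  induction x using Completion.induction_on with
  | hp => exact isClosed_eq (by fun_prop) (by fun_prop)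
  | ih b =>
    rw [f.gnsStarAlgHom_apply_coe, hE, hE, ← σ.π_mul_apply, PositiveLinearMap.ofPreGNS_toPreGNS]

end CyclicVectors

/-! ### Product states: irreducibility and tail equivalence -/

section ProductStates

open scoped ComplexOrder InnerProductSpace Matrix.Norms.L2Operator

variable {n : ℕ} [NeZero n]

lemma UHF.dense_iUnion_range_of (n : ℕ) [NeZero n] :
    Dense (⋃ k, Set.range (UHF.of n k)) := by
  refine (uhfNorm n).denseRange_of.mono ?_
  rintro _ ⟨x, rfl⟩
  induction x using DirectLimit.induction with
  | _ k M => exact Set.mem_iUnion.mpr ⟨k, M, rfl⟩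

lemma UHF.induction_on {p : UHF n → Prop} (a : UHF n) (hp : IsClosed {a | p a})
    (h : ∀ k (M : MatPow n k), p (UHF.of n k M)) : p a := by
  have : closure (⋃ k, Set.range (UHF.of n k)) ⊆ {a | p a} := by
    refine hp.closure_subset_iff.mpr (Set.iUnion_subset fun k => ?_)
    rintro _ ⟨M, rfl⟩
    exact h k M
  exact this ((UHF.dense_iUnion_range_of n).closure_eq ▸ Set.mem_univ a)

/-- The projection `E_{j_1,j_1} ⊗ ⋯ ⊗ E_{j_k,j_k}` in `UHF_n`. -/
noncomputable def uhfProj (J : ℕ → Fin n) (k : ℕ) : UHF n :=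
  UHF.of n k (Matrix.single (seqInit J k) (seqInit J k) 1)

lemma star_uhfProj (J : ℕ → Fin n) (k : ℕ) : star (uhfProj J k) = uhfProj J k := by
  rw [uhfProj, ← map_star, Matrix.star_eq_conjTranspose, Matrix.conjTranspose_single, star_one]

lemma uhfProj_mul_self (J : ℕ → Fin n) (k : ℕ) : uhfProj J k * uhfProj J k = uhfProj J k := by
  rw [uhfProj, ← map_mul, Matrix.single_mul_single_same, one_mul]

lemma norm_uhfProj_le (J : ℕ → Fin n) (k : ℕ) : ‖uhfProj J k‖ ≤ 1 := by
  have h : ‖star (uhfProj J k) * uhfProj J k‖ = ‖uhfProj J k‖ * ‖uhfProj J k‖ :=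
    CStarRing.norm_star_mul_self
  rw [star_uhfProj, uhfProj_mul_self] at h
  nlinarith [norm_nonneg (uhfProj J k)]

/-- Compression between rank-one projections leaves a single matrix entry. Taking `J = J'` isolates
the value of the state; for distinct sequences the entry vanishes when `M` comes from a stage after
which the segments still differ. -/
lemma uhfProj_mul_of_mul_uhfProj (J J' : ℕ → Fin n) (k : ℕ) (M : MatPow n k) :
    uhfProj J k * UHF.of n k M * uhfProj J' k =
      M (seqInit J k) (seqInit J' k) • UHF.of n k (Matrix.single (seqInit J k) (seqInit J' k) 1) := by
  rw [uhfProj, uhfProj, ← map_mul, ← map_mul, ← map_smul, Matrix.single_mul_mul_single]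
  simp

omit [NeZero n] in
lemma seqInit_embed (J J' : ℕ → Fin n) {k l : ℕ} (h : k ≤ l) (M : MatPow n k)
    (hJ : ∀ i, k ≤ i → J i = J' i) :
    matPowEmbed n k l h M (seqInit J l) (seqInit J' l) = M (seqInit J k) (seqInit J' k) := by
  have ht : TailEq k (seqInit J l) (seqInit J' l) := fun i hi => hJ i hi
  rw [matPowEmbed_apply, if_pos ht]
  rfl

/-- The closure of the orbit is a closed invariant subspace, and it contains `x` because `1` acts as
the identity. -/
lemma StarRep.dense_of_isIrreducible {A : Type} [CStarAlgebra A] {σ : StarRep A} (h : σ.IsIrreducible)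
    {x : σ.H} (hx : x ≠ 0) : DenseRange fun a => σ.π a x := by
  let R : Submodule ℂ σ.H := LinearMap.range
    ({ toFun := fun a => σ.π a x
       map_add' := fun a b => by rw [map_add]; rfl
       map_smul' := fun c a => by rw [map_smul]; rfl } : A →ₗ[ℂ] σ.H)
  have hR : ∀ a, ∀ y ∈ R.topologicalClosure, σ.π a y ∈ R.topologicalClosure := fun a =>
    fun y hy => map_mem_closure (σ.π a).continuous hy (by
      rintro _ ⟨b, rfl⟩
      exact ⟨a * b, σ.π_mul_apply a b x⟩)
  have hxR : x ∈ R.topologicalClosure := R.le_topologicalClosure ⟨1, σ.π_one_apply x⟩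
  rcases h.2 _ R.isClosed_topologicalClosure hR with h0 | h1
  · rw [h0, Submodule.mem_bot] at hxR
    exact absurd hxR hx
  · intro y
    have : y ∈ R.topologicalClosure := h1 ▸ Submodule.mem_top
    exact this

omit [NeZero n] in
-- Because the tails agree from `r` on, tensoring the matrix unit with the identity gives an
-- operator sending the basis vector of the `J` segment to that of the `J'` segment. The equation
-- describes that column.
lemma embed_single_apply {J J' : ℕ → Fin n} {r k : ℕ} (hk : r ≤ k) (hr : ∀ i ≥ r, J i = J' i)
    (L : Fin k → Fin n) :
    matPowEmbed n r k hk (Matrix.single (seqInit J' r) (seqInit J r) 1) L (seqInit J k) =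
      if L = seqInit J' k then 1 else 0 := by
  have ht : TailEq r (seqInit J' k) (seqInit J k) := fun i hi => (hr i hi).symm
  rw [matPowEmbed_apply]
  by_cases hL : L = seqInit J' k
  · subst hL
    rw [if_pos ht, if_pos rfl]
    exact Matrix.single_apply_same _ _ _
  · rw [if_neg hL]
    split_ifs with hLJ
    · rw [Matrix.single_apply, if_neg]
      exact fun e => hL (tuple_ext hk (fun i hi => (hLJ i hi).trans (ht i hi).symm) e.1.symm)
    · rfl

namespace StarRep.IsGNSVector

variable {σ : StarRep (UHF n)} {J : ℕ → Fin n} {Ω : σ.H}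

lemma inner_self (h : σ.IsGNSVector (uhfState n J) Ω) : ⟪Ω, Ω⟫_ℂ = 1 := by
  have := h.inner_eq 1
  rwa [σ.π_one_apply, uhfState_one] at this

lemma ne_zero (h : σ.IsGNSVector (uhfState n J) Ω) : Ω ≠ 0 := by
  rintro rfl
  simpa using h.inner_self

/-- The state takes the value `1` on the projection `p`, so `‖pΩ - Ω‖² = 1 - 1 - 1 + 1 = 0`. -/
lemma uhfProj_apply (h : σ.IsGNSVector (uhfState n J) Ω) (k : ℕ) :
    σ.π (uhfProj J k) Ω = Ω := by
  have h1 : ⟪Ω, σ.π (uhfProj J k) Ω⟫_ℂ = 1 := by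
    rw [h.inner_eq, uhfProj, uhfState_single, if_pos ⟨rfl, rfl⟩]
  have h2 : ⟪σ.π (uhfProj J k) Ω, Ω⟫_ℂ = 1 := by
    rw [← star_uhfProj, σ.inner_star_apply, h1]
  have h3 : ⟪σ.π (uhfProj J k) Ω, σ.π (uhfProj J k) Ω⟫_ℂ = 1 := by
    nth_rewrite 1 [← star_uhfProj]
    rw [σ.inner_star_apply, ← σ.π_mul_apply, uhfProj_mul_self, h1]
  rw [← sub_eq_zero, ← inner_self_eq_zero (𝕜 := ℂ), inner_sub_left, inner_sub_right,
    inner_sub_right, h1, h2, h3, h.inner_self]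
  simp

lemma uhfProj_of_apply (h : σ.IsGNSVector (uhfState n J) Ω) {k l : ℕ} (hkl : k ≤ l)
    (M : MatPow n k) :
    σ.π (uhfProj J l) (σ.π (UHF.of n k M) Ω) = ⟪Ω, σ.π (UHF.of n k M) Ω⟫_ℂ • Ω := by
  -- Inserting the projection in front of `Ω` and moving `M` to stage `l` turns the operator into a
  -- compression of one matrix.
  conv_lhs => rw [← h.uhfProj_apply l, ← UHF.of_embed n k l hkl]
  rw [← σ.π_mul_apply, ← σ.π_mul_apply, uhfProj_mul_of_mul_uhfProj, map_smul,
    seqInit_embed J J hkl M (fun _ _ => rfl), h.inner_eq, uhfState_of]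
  exact congrArg _ (h.uhfProj_apply l)

lemma dense_local (h : σ.IsGNSVector (uhfState n J) Ω) (x : σ.H) {ε : ℝ} (hε : 0 < ε) :
    ∃ (k : ℕ) (M : MatPow n k), ‖x - σ.π (UHF.of n k M) Ω‖ < ε := by
  have hd := h.dense.dense_image (σ.continuous_π_apply Ω) (UHF.dense_iUnion_range_of n)
  obtain ⟨_, hxa, ⟨a, ha, rfl⟩⟩ := Metric.dense_iff.mp hd x ε hε
  obtain ⟨k, M, rfl⟩ := Set.mem_iUnion.mp ha
  exact ⟨k, M, by rwa [Metric.mem_ball, dist_comm, dist_eq_norm] at hxa⟩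

open Filter Topology in
-- On the dense set of vectors `σ(M)Ω`, with `M` in a finite stage, the sequence is eventually
-- constant; the projections are contractions, so convergence passes to all vectors.
lemma tendsto_uhfProj (h : σ.IsGNSVector (uhfState n J) Ω) (x : σ.H) :
    Tendsto (fun l => σ.π (uhfProj J l) x) atTop (𝓝 (⟪Ω, x⟫_ℂ • Ω)) := by
  have hΩ : ‖Ω‖ = 1 := by
    have := h.inner_self
    rw [inner_self_eq_norm_sq_to_K] at this
    exact (pow_eq_one_iff_of_nonneg (norm_nonneg Ω) two_ne_zero).mp (Complex.ofReal_injective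
      ((Complex.ofReal_pow _ _).trans this))
  rw [Metric.tendsto_atTop]
  intro ε hε
  obtain ⟨k, M, hM⟩ := h.dense_local x (half_pos hε)
  refine ⟨k, fun l hl => ?_⟩
  set y := σ.π (UHF.of n k M) Ω
  -- Projection and limit operator agree on `y`, so only `x - y` contributes; each of the two terms
  -- is bounded by `‖x - y‖ < ε / 2`.
  have e : σ.π (uhfProj J l) x - ⟪Ω, x⟫_ℂ • Ω =
      σ.π (uhfProj J l) (x - y) - ⟪Ω, x - y⟫_ℂ • Ω := by
    rw [map_sub, h.uhfProj_of_apply hl, inner_sub_right, sub_smul]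
    abel
  have e1 : ‖σ.π (uhfProj J l) (x - y)‖ ≤ ‖x - y‖ :=
    (σ.norm_π_apply_le _ _).trans (mul_le_of_le_one_left (norm_nonneg _) (norm_uhfProj_le J l))
  have e2 : ‖⟪Ω, x - y⟫_ℂ • Ω‖ ≤ ‖x - y‖ := by
    rw [norm_smul, hΩ, mul_one]
    exact (norm_inner_le_norm Ω (x - y)).trans_eq (by rw [hΩ, one_mul])
  rw [dist_eq_norm, e]
  linarith [norm_sub_le (σ.π (uhfProj J l) (x - y)) (⟪Ω, x - y⟫_ℂ • Ω)]

/-- A closed invariant `K` is stable under the strong limit of the projections, the projection onto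
`ℂΩ`. So `Ω ∈ K` or `K ⊥ Ω`. -/
lemma isIrreducible (h : σ.IsGNSVector (uhfState n J) Ω) : σ.IsIrreducible := by
  refine ⟨⟨Ω, 0, h.ne_zero⟩, fun K hK hinv => ?_⟩
  have hmem : ∀ x ∈ K, ⟪Ω, x⟫_ℂ • Ω ∈ K := fun x hx =>
    hK.mem_of_tendsto (h.tendsto_uhfProj x) (.of_forall fun l => hinv _ x hx)
  by_cases hΩ : Ω ∈ K
  · right
    refine eq_top_iff.mpr fun x _ => ?_
    have : closure (Set.range fun a => σ.π a Ω) ⊆ K :=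
      hK.closure_subset_iff.mpr (by rintro _ ⟨a, rfl⟩; exact hinv a Ω hΩ)
    exact this (h.dense x)
  · left
    refine (Submodule.eq_bot_iff K).mpr fun x hx => ?_
    have horth : ∀ y ∈ K, ⟪Ω, y⟫_ℂ = 0 := fun y hy => by
      by_contra hne
      exact hΩ ((K.smul_mem_iff hne).mp (hmem y hy))
    -- Moving `a` across the inner product, orthogonality of `K` to `Ω` becomes orthogonality to the
    -- whole orbit, which is dense.
    have hx0 : ∀ y, ⟪y, x⟫_ℂ = 0 := fun y => by
      refine h.dense.induction_on (p := fun y => ⟪y, x⟫_ℂ = 0) y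
        (isClosed_eq (by fun_prop) continuous_const) fun a => ?_
      rw [← star_star a, σ.inner_star_apply]
      exact horth _ (hinv _ x hx)
    exact inner_self_eq_zero.mp (hx0 x)

lemma of_unitaryEquiv {A : Type} [CStarAlgebra A] [PartialOrder A] {σ ρ : StarRep A}
    {f : A →ₚ[ℂ] ℂ} {Ω : σ.H} (h : σ.IsGNSVector f Ω) (U : σ.H ≃ₗᵢ[ℂ] ρ.H)
    (hU : ∀ a x, U (σ.π a x) = ρ.π a (U x)) : ρ.IsGNSVector f (U Ω) where
  inner_eq a := by rw [← hU, U.inner_map_map, h.inner_eq]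
  dense := by
    simp_rw [← hU]
    exact U.surjective.denseRange.comp h.dense U.continuous

/-- If the sequences differ at arbitrarily late positions, `Ω` is approximated by vectors killed by
a contraction that fixes `Ω`, so `Ω = 0`. -/
lemma tailEquiv {J' : ℕ → Fin n} {Ω' : σ.H} (h : σ.IsGNSVector (uhfState n J) Ω)
    (h' : σ.IsGNSVector (uhfState n J') Ω') : TailEquiv J J' := by
  by_contra hne
  refine h.ne_zero (norm_le_zero_iff.mp (le_of_forall_pos_le_add fun ε hε => ?_))
  obtain ⟨k, M, hM⟩ := h'.dense_local Ω hε
  obtain ⟨i, hki, hi⟩ : ∃ i ≥ k, J i ≠ J' i := by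
    by_contra! hall
    exact hne ⟨k, hall⟩
  -- Positions are counted from `0`, so `i + 1` is the first stage whose segments contain the
  -- position `i` of disagreement.
  have hkl : k ≤ i + 1 := hki.trans (Nat.le_succ i)
  have h0 : σ.π (uhfProj J (i + 1)) (σ.π (UHF.of n k M) Ω') = 0 := by
    have ht : ¬ TailEq k (seqInit J (i + 1)) (seqInit J' (i + 1)) := fun ht =>
      hi (ht ⟨i, Nat.lt_succ_self i⟩ hki)
    conv_lhs => rw [← h'.uhfProj_apply (i + 1), ← UHF.of_embed n k (i + 1) hkl]
    rw [← σ.π_mul_apply, ← σ.π_mul_apply, uhfProj_mul_of_mul_uhfProj, matPowEmbed_apply,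
      if_neg ht, zero_smul, map_zero]
    rfl
  calc ‖Ω‖ = ‖σ.π (uhfProj J (i + 1)) (Ω - σ.π (UHF.of n k M) Ω')‖ := by
        rw [map_sub, h0, sub_zero, h.uhfProj_apply]
    _ ≤ ‖Ω - σ.π (UHF.of n k M) Ω'‖ :=
        (σ.norm_π_apply_le _ _).trans (mul_le_of_le_one_left (norm_nonneg _) (norm_uhfProj_le J _))
    _ ≤ 0 + ε := by rw [zero_add]; exact hM.le

/-- To check that a vector implements a product state it is enough to look at all sufficiently
late stages. -/
lemma uhf_inner_eq {x : σ.H} (r : ℕ)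
    (hx : ∀ k, r ≤ k → ∀ M : MatPow n k,
      ⟪x, σ.π (UHF.of n k M) x⟫_ℂ = M (seqInit J k) (seqInit J k)) (a : UHF n) :
    ⟪x, σ.π a x⟫_ℂ = uhfState n J a := by
  induction a using UHF.induction_on with
  | hp =>
    have h1 : Continuous (uhfState n J) := ((uhfNorm n).extendL (uhfStateLocal n J) _).continuous
    exact isClosed_eq (continuous_const.inner (σ.continuous_π_apply x)) h1
  | h k M =>
    -- A matrix of any stage is also one of stage `max k r`, where the hypothesis applies.
    rw [← UHF.of_embed n k (max k r) (le_max_left k r), hx _ (le_max_right k r), uhfState_of]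

/-- The new vector is `σ(E)Ω`, where `E` is the matrix unit of stage `r` with row the segment of
`J'` and column that of `J`. -/
lemma exists_of_tailEquiv {J' : ℕ → Fin n} (h : σ.IsGNSVector (uhfState n J) Ω)
    (hJ : TailEquiv J J') : ∃ Ω', σ.IsGNSVector (uhfState n J') Ω' := by
  obtain ⟨r, hr⟩ := hJ
  have hstate : ∀ a, ⟪σ.π (UHF.of n r (Matrix.single (seqInit J' r) (seqInit J r) 1)) Ω,
      σ.π a (σ.π (UHF.of n r (Matrix.single (seqInit J' r) (seqInit J r) 1)) Ω)⟫_ℂ =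
        uhfState n J' a := by
    -- From stage `r` on, `E` and `M` lie in one matrix algebra, and the claim is that the `J`
    -- diagonal entry of `E* M E` is the `J'` diagonal entry of `M`.
    refine uhf_inner_eq r fun k hk M => ?_
    rw [← star_star (UHF.of n r _), σ.inner_star_apply, star_star, ← σ.π_mul_apply,
      ← σ.π_mul_apply, h.inner_eq, ← UHF.of_embed n r k hk, ← map_star, ← map_mul, ← map_mul,
      uhfState_of]
    simp [Matrix.mul_apply, Matrix.star_apply, embed_single_apply hk hr]
  -- Irreducibility makes any nonzero vector cyclic; this one is nonzero because its functional is
  -- `1` at the unit.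
  refine ⟨_, hstate, StarRep.dense_of_isIrreducible h.isIrreducible fun h0 => ?_⟩
  have := hstate 1
  rw [h0, uhfState_one, inner_zero_left] at this
  exact zero_ne_one this

end StarRep.IsGNSVector
end ProductStates

/-! ### Product vectors under the Kronecker coproduct -/

section KroneckerProduct

open scoped ComplexOrder InnerProductSpace TensorProduct Matrix.Norms.L2Operator
open UniformSpace

variable {n m : ℕ} [NeZero n] [NeZero m]

omit [NeZero n] [NeZero m] in
lemma digitEquiv_seqStar (J : ℕ → Fin n) (K : ℕ → Fin m) (k : ℕ) :
    digitEquiv n m k (seqInit (seqStar J K) k) = (seqInit J k, seqInit K k) := by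
  refine Prod.ext (funext fun i => ?_) (funext fun i => ?_)
  · exact congrArg Prod.fst (finProdFinEquiv.symm_apply_apply (J i, K i))
  · exact congrArg Prod.snd (finProdFinEquiv.symm_apply_apply (J i, K i))

/-- On each stage `φ` inverts the Kronecker product, so a Kronecker product of matrices acts
factorwise on elementary tensors. -/
lemma StarRep.ptimes_kron_apply (ρ : StarRep (UHF n)) (σ : StarRep (UHF m)) (k : ℕ)
    (M : MatPow n k) (N : MatPow m k) (x : ρ.H) (y : σ.H) :
    (ρ.ptimes σ).π (UHF.of (n * m) k ((kronCoproduct n m k).symm (M ⊗ₜ N)))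
      ((x ⊗ₜ[ℂ] y : ρ.H ⊗[ℂ] σ.H) : HilbertTensor ρ.H σ.H) =
    ((ρ.π (UHF.of n k M) x ⊗ₜ[ℂ] σ.π (UHF.of m k N) y : ρ.H ⊗[ℂ] σ.H) :
      HilbertTensor ρ.H σ.H) := by
  change (ρ.tensor σ).π (phi n m _) _ = _
  rw [phi_of, StarAlgEquiv.apply_symm_apply, starTensorMap_tmul, StarRep.tensor_of,
    StarRep.algTensor_tmul]
  exact opTensor_coe _ _ _

lemma hilbertTensor_mem_of_tmul_mem {H K : Type} [NormedAddCommGroup H] [InnerProductSpace ℂ H]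
    [NormedAddCommGroup K] [InnerProductSpace ℂ K] (S : Submodule ℂ (HilbertTensor H K))
    (hS : IsClosed (S : Set (HilbertTensor H K)))
    (h : ∀ x y, ((x ⊗ₜ[ℂ] y : H ⊗[ℂ] K) : HilbertTensor H K) ∈ S) (v : HilbertTensor H K) :
    v ∈ S := by
  induction v using Completion.induction_on with
  | hp => exact hS
  | ih v =>
    induction v with
    | zero => exact S.zero_mem
    | add v w hv hw => rw [Completion.coe_add]; exact S.add_mem hv hw
    | tmul x y => exact h x y

lemma continuous_coe_tmul {H K : Type} [NormedAddCommGroup H] [InnerProductSpace ℂ H]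
    [NormedAddCommGroup K] [InnerProductSpace ℂ K] :
    Continuous fun p : H × K => ((p.1 ⊗ₜ[ℂ] p.2 : H ⊗[ℂ] K) : HilbertTensor H K) := by
  refine (Completion.continuous_coe _).comp ?_
  -- The bound `1` comes from the identity `‖x ⊗ y‖ = ‖x‖ ‖y‖`.
  exact ((TensorProduct.mk ℂ H K).mkContinuous₂ 1 fun x y => by simp).continuous₂

/-- On elementary tensors of matrices both the vector functional and the diagonal entry at `J ⋆ K`
factor, which identifies the states. Cyclicity follows because elementary tensors of orbit vectors
are limits of orbit vectors of `Ω ⊗ Ω'`. -/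
lemma StarRep.IsGNSVector.ptimes {ρ : StarRep (UHF n)} {σ : StarRep (UHF m)} {J : ℕ → Fin n}
    {K : ℕ → Fin m} {Ω : ρ.H} {Ω' : σ.H} (h : ρ.IsGNSVector (uhfState n J) Ω)
    (h' : σ.IsGNSVector (uhfState m K) Ω') :
    (ρ.ptimes σ).IsGNSVector (uhfState (n * m) (seqStar J K))
      ((Ω ⊗ₜ[ℂ] Ω' : ρ.H ⊗[ℂ] σ.H) : HilbertTensor ρ.H σ.H) where
  inner_eq := by
    set Ψ : (ρ.ptimes σ).H := ((Ω ⊗ₜ[ℂ] Ω' : ρ.H ⊗[ℂ] σ.H) : HilbertTensor ρ.H σ.H) with hΨ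
    refine uhf_inner_eq (x := Ψ) 0 fun k _ M => ?_
    obtain ⟨x, rfl⟩ : ∃ x, (kronCoproduct n m k).symm x = M :=
      ⟨kronCoproduct n m k M, StarAlgEquiv.symm_apply_apply _ _⟩
    induction x with
    | zero =>
      rw [map_zero, map_zero, map_zero]
      exact inner_zero_right Ψ
    | add x y hx hy =>
      rw [map_add, map_add, map_add, Matrix.add_apply, ← hx, ← hy]
      exact inner_add_right Ψ _ _
    | tmul M N =>
      rw [hΨ, StarRep.ptimes_kron_apply, kronCoproduct_symm_tmul, digitEquiv_seqStar]
      refine (Completion.inner_coe _ _).trans ?_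
      rw [TensorProduct.inner_tmul, h.inner_eq, h'.inner_eq, uhfState_of, uhfState_of]
  dense := by
    set Ψ : (ρ.ptimes σ).H := ((Ω ⊗ₜ[ℂ] Ω' : ρ.H ⊗[ℂ] σ.H) : HilbertTensor ρ.H σ.H) with hΨ
    let R : Submodule ℂ (ρ.ptimes σ).H := LinearMap.range
      ({ toFun := fun a => (ρ.ptimes σ).π a Ψ
         map_add' := fun a b => by rw [map_add]; rfl
         map_smul' := fun c a => by rw [map_smul]; rfl } : UHF (n * m) →ₗ[ℂ] (ρ.ptimes σ).H)
    intro v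
    change v ∈ R.topologicalClosure
    refine hilbertTensor_mem_of_tmul_mem R.topologicalClosure R.isClosed_topologicalClosure
      (fun x y => ?_) v
    -- Closedness in the pair `(x, y)` allows each factor to be approximated separately, first by
    -- the algebra elements of finite stages and then by orbit vectors.
    have hclosed : IsClosed {p : ρ.H × σ.H |
        ((p.1 ⊗ₜ[ℂ] p.2 : ρ.H ⊗[ℂ] σ.H) : HilbertTensor ρ.H σ.H) ∈ R.topologicalClosure} :=
      R.isClosed_topologicalClosure.preimage continuous_coe_tmul
    have hmem : ∀ (a : UHF n) (b : UHF m), ((ρ.π a Ω ⊗ₜ[ℂ] σ.π b Ω' : ρ.H ⊗[ℂ] σ.H) :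
        HilbertTensor ρ.H σ.H) ∈ R.topologicalClosure := fun a b => by
      induction a using UHF.induction_on with
      | hp => exact hclosed.preimage ((ρ.continuous_π_apply Ω).prodMk continuous_const)
      | h k M =>
      induction b using UHF.induction_on with
      | hp => exact hclosed.preimage (continuous_const.prodMk (σ.continuous_π_apply Ω'))
      | h l N =>
        -- The two matrices may come from different stages; both are embedded in stage `max k l`,
        -- where their Kronecker product is defined.
        refine R.le_topologicalClosure ⟨UHF.of (n * m) (max k l) ((kronCoproduct n m _).symm
          (matPowEmbed n k _ (le_max_left k l) M ⊗ₜ matPowEmbed m l _ (le_max_right k l) N)), ?_⟩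
        refine (StarRep.ptimes_kron_apply _ _ _ _ _ _ _).trans ?_
        rw [UHF.of_embed, UHF.of_embed]
    exact (h.dense.prodMap h'.dense).induction_on (p := fun p : ρ.H × σ.H =>
      ((p.1 ⊗ₜ[ℂ] p.2 : ρ.H ⊗[ℂ] σ.H) : HilbertTensor ρ.H σ.H) ∈ R.topologicalClosure)
      (x, y) hclosed fun p => hmem p.1 p.2

end KroneckerProduct

/-! ### The three assertions -/

theorem mainTheorem5 (n m : ℕ) [NeZero n] [NeZero m] (hn : 2 ≤ n) (hm : 2 ≤ m) :
    (∀ J : ℕ → Fin n, (uhfRep n J).IsIrreducible) ∧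
    (∀ J J' : ℕ → Fin n, uhfClass n J = uhfClass n J' ↔ TailEquiv J J') ∧
    (∀ (J : ℕ → Fin n) (K : ℕ → Fin m),
      (uhfClass n J).ptimes (uhfClass m K) = uhfClass (n * m) (seqStar J K)) := by
  refine ⟨fun J => ?_, fun J J' => ⟨fun hJ => ?_, fun hJ => ?_⟩, fun J K => ?_⟩
  · obtain ⟨Ω, h⟩ := StarRep.exists_isGNSVector_gns (uhfState n J)
    exact h.isIrreducible
  · obtain ⟨U, hU⟩ := Quotient.exact hJ
    obtain ⟨Ω, h⟩ := StarRep.exists_isGNSVector_gns (uhfState n J)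
    obtain ⟨Ω', h'⟩ := StarRep.exists_isGNSVector_gns (uhfState n J')
    -- The unitary carries `Ω` into the space of `π_{J'}`, so that both cyclic vectors belong to the
    -- same representation.
    exact StarRep.IsGNSVector.tailEquiv (h.of_unitaryEquiv U hU) h'
  · obtain ⟨Ω, h⟩ := StarRep.exists_isGNSVector_gns (uhfState n J)
    obtain ⟨Ω', h'⟩ := h.exists_of_tailEquiv hJ
    -- Here `π_J` itself carries a cyclic vector for `ω_{J'}`; uniqueness of the GNS representation
    -- gives an equivalence from `π_{J'}` to `π_J`, hence the symmetry.
    exact Eq.symm (Quotient.sound h'.gns_unitaryEquiv)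
  · obtain ⟨Ω, h⟩ := StarRep.exists_isGNSVector_gns (uhfState n J)
    obtain ⟨Ω', h'⟩ := StarRep.exists_isGNSVector_gns (uhfState m K)
    exact Eq.symm (Quotient.sound (h.ptimes h').gns_unitaryEquiv)
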